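/- **Setting.** A network has $p$ servers, $m\ge 1$ buffers and $n$ activities; activity $j$ is performed by server $s(j)$ on jobs of buffer $b(j)$, and every server and every buffer has at least one activity. Let $A_{kj}=1_{\{s(j)=k\}}$ and $C_{ij}=1_{\{b(j)=i\}}$. Jobs arrive at buffer $k$ at rate $\lambda_k\ge 0$ (not all zero), with interarrival times $u_k(i)=\bar u_k(i)/\lambda_k$ if $\lambda_k\neq0$ and no arrivals otherwise; the service times of activity $j$ are $v_j(i)=m_j\bar v_j(i)$ with $m_j>0$, $\mu_j=1/m_j$; the $i$th job completed by activity $j$ is routed according to $\phi_j(i)\in\{0,e_1,\dots,e_m\}$ ($0$: it leaves, $e_l$: it moves to buffer $l$), and $P_{jl}=\mathbf P(\phi_j(1)=e_l)$. The $2n+m$ sequences $\bar u_k,\bar v_j,\phi_j$ live on one probability space and are mutually independent, each is i.i.d., and $\bar u_k,\bar v_j$ are strictly positive with mean $1$. For some $\varepsilon_1\in(0,1)$, $\mathbf E|\bar u_k(1)|^{2+2\varepsilon_1}<\infty$ and $\mathbf E|\bar v_j(1)|^{2+2\varepsilon_1}<\infty$ for all $k,j$. Let $R=(C-P')\,\mathrm{diag}(\mu)$,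 $E_k(t)=\max\{l:\sum_{i\le l}u_k(i)\le t\}$ (with $E_k\equiv0$ if $\lambda_k=0$), $V_j(l)=\sum_{i\le l}v_j(i)$, $S_j(t)=\max\{l: V_j(l)\le t\}$ and $\Phi_j(l)=\sum_{i\le l}\phi_j(i)$. **Assumptions.** (Heavy traffic) The problem of minimizing $\rho$ subject to $Rx=\lambda$, $Ax\le\rho e$, $x\ge0$ has a unique solution $(\rho^*,x^*)$, and $\rho^*=1$, $Ax^*=e$. Activities with $x^*_j>0$ are called basic, $b$ is their number, and $H$, $B$ are the submatrices of $R$, $A$ formed by the basic columns. For each buffer $i$ there is a basic $j$ with $R_{ij}>0$. (Complete resource pooling) $p+m-b=1$. Let $(y,\pi)$ be determined by $y'H=\pi'B$, $\pi'e=1$, and let $$\Pi=\begin{bmatrix}H&e_1\\B&0\end{bmatrix},\qquad C_0=\min_{j\text{ basic},\,i\le m}\frac{x_j^*}{|(\Pi^{-1}e^i)_j|}\ \ (\text{quotients with denominator }0\text{ are }+\infty),\qquad C_1=C_0\max_j\frac{y_j}{y_1},$$ $$\theta^*=n\big[(2+C_1+C_0)(1\vee\max_j\mu_j)+1\big]e,\qquad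 0<\delta<\frac{C_0}{2m\,[1+(\sum_i y_i)\max_k\lambda_k]}.$$ Buffer $1$ is an arbitrary designated buffer (in the application, the cheapest one, with the smallest ratio of holding cost to $y_i$). **Dynamics.** Under a cumulative time allocation $T=(T_j(t))$ with $Z(0)=\theta$, the buffer contents are $Z(t)=\theta+E(t)+\sum_j\Phi_j(S_j(T_j(t)))-CS(T(t))$. $T$ is admissible if $T(0)=0$, $T$ is nondecreasing, $A(T(t)-T(s))\le e(t-s)$ for $s\le t$, and $Z\ge0$. **Discrete review policy** with nominal period length $l$ and safety stocks $\theta=\theta^*l$. The state is reviewed at times $0=\tau_0<\tau_1<\cdots$. If $q=Z(\tau_k)$ is observed, all servers first idle for $I=[y'(\theta-q)]^+$ time units; then follows a processing span of length $L$, and $\tau_{k+1}=\tau_k+I+L$. During that span activity $j$ is scheduled for $w_j$ time units, in an arbitrary order or at arbitrary rates within the capacity of the servers, and $w_j=0$ for nonbasic $j$. *Case 1:* $q_1>\theta_1-\delta l$ and $|q_i-\theta_i|<\delta l$ for $i\ge2$. Then $L=l$ and $w_B$ consists of the first $b$ entries of $\Pi^{-1}\begin{bmatrix}q+\lambda(l+I)-\theta\\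 el\end{bmatrix}$; an activity $j$ may process at most $q_{b(j)}/n$ jobs in the period, and otherwise follows its schedule. *Case 2:* otherwise. Put $\tilde q=q+\lambda I$ and let $C_s$ be the maximum of $1$ and of $\big|\tfrac1l\big(\Pi^{-1}\begin{bmatrix}\theta-\tilde q\\0\end{bmatrix}\big)_j\big|/x_j^*$ over basic $j$. Then $L=C_sl$ and $w_j=C_sx_jl$ with $x_j=x_j^*(1-\tfrac1{C_s})+\tfrac1{C_sl}\big(\Pi^{-1}\begin{bmatrix}\tilde q+\lambda l-\theta\\ el\end{bmatrix}\big)_j$ for basic $j$. An activity never receives more than its scheduled effort, and none while its buffer is empty (contains no whole job), and it follows its schedule as long as its buffer has not run short of jobs (i.e. has held at least as many jobs as there are basic activities that share it); beyond this, the resolution of shortages is arbitrary. **Theorem 1 (State space collapse).** Let $0<\varepsilon_2<\varepsilon_1/3$, $l(r)=r^{1-\varepsilon_2}$ and $\theta(r)=\theta^*l(r)$. For $r=1,2,\dots$ let $T^r$ be an admissible allocation process which almost surely follows the discrete review policy with parameters $l(r),\theta(r)$, started from $Z^r(0)=\theta(r)$ with no partially completed jobs, and let $\widehat Z^r(s)=\frac1rZ^r(r^2s)$.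 Then for each fixed $T>0$ and each $k=2,\dots,m$, the supremum $\sup_{0\le s\le T}\widehat Z^r_k(s)$ is almost surely finite for every $r$ and converges to $0$ in probability as $r\to\infty$. -/

import Mathlib

open MeasureTheory ProbabilityTheory Filter Topology
open scoped Matrix

noncomputable section

/-- First-order data of an open processing network with `p` servers, `m` buffers and `n` activities.
Activity `j` is carried out by `server j` on jobs of `buffer j`; `arrivalRate` is `λ`, `meanService j`
is the mean service time `m_j`, and `routing j l` is the probability that a job completed by activity
`j` moves to buffer `l` (it leaves the network with the remaining probability). -/
structure Network (p m n : ℕ) where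
  server : Fin n → Fin p
  buffer : Fin n → Fin m
  arrivalRate : Fin m → ℝ
  meanService : Fin n → ℝ
  routing : Matrix (Fin n) (Fin m) ℝ
  server_surjective : Function.Surjective server
  buffer_surjective : Function.Surjective buffer
  arrivalRate_nonneg : ∀ k, 0 ≤ arrivalRate k
  exists_arrivalRate_ne_zero : ∃ k, arrivalRate k ≠ 0
  meanService_pos : ∀ j, 0 < meanService j

namespace Network

variable {p m n : ℕ}

/-- Capacity consumption matrix `A`. -/
def capacityMatrix (N : Network p m n) : Matrix (Fin p) (Fin n) ℝ :=
  Matrix.of fun k j => if N.server j = k then 1 else 0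

/-- Constituency matrix `C`. -/
def constituencyMatrix (N : Network p m n) : Matrix (Fin m) (Fin n) ℝ :=
  Matrix.of fun i j => if N.buffer j = i then 1 else 0

/-- Service rate `μ_j = 1 / m_j`. -/
def serviceRate (N : Network p m n) (j : Fin n) : ℝ := 1 / N.meanService j

/-- Input-output matrix `R = (C - P') M⁻¹`, `M = diag(m_1, …, m_n)`. -/
def inputOutput (N : Network p m n) : Matrix (Fin m) (Fin n) ℝ :=
  (N.constituencyMatrix - N.routingᵀ) * Matrix.diagonal N.serviceRate

/-! ### The static planning problem -/

/-- Feasibility of `(ρ, x)` in the static planning problem: `R x = λ`, `A x ≤ ρ e`, `x ≥ 0`. -/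
def IsFeasible (N : Network p m n) (ρ : ℝ) (x : Fin n → ℝ) : Prop :=
  N.inputOutput *ᵥ x = N.arrivalRate ∧ (∀ k, (N.capacityMatrix *ᵥ x) k ≤ ρ) ∧ ∀ j, 0 ≤ x j

/-- `(ρ, x)` solves the static planning problem: it is feasible, with the smallest possible `ρ`. -/
def IsOptimal (N : Network p m n) (ρ : ℝ) (x : Fin n → ℝ) : Prop :=
  N.IsFeasible ρ x ∧ ∀ ρ' x', N.IsFeasible ρ' x' → ρ ≤ ρ'

/-- Heavy traffic: the static planning problem has the unique solution `(1, xs)`, and `A xs = e`. -/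
def HeavyTraffic (N : Network p m n) (xs : Fin n → ℝ) : Prop :=
  N.IsOptimal 1 xs ∧ (∀ ρ x, N.IsOptimal ρ x → ρ = 1 ∧ x = xs) ∧
    ∀ k, (N.capacityMatrix *ᵥ xs) k = 1

/-- The basic activities of the nominal plan `xs`. -/
abbrev Basic (xs : Fin n → ℝ) : Type := {j : Fin n // 0 < xs j}

/-- Each buffer `i` has a basic activity `j` with `R_{ij} > 0`. -/
def BasicActivityForEachBuffer (N : Network p m n) (xs : Fin n → ℝ) : Prop :=
  ∀ i, ∃ j, 0 < xs j ∧ 0 < N.inputOutput i j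

/-- Complete resource pooling: `p + m - b = 1`, with `b` the number of basic activities. -/
def CompleteResourcePooling (_N : Network p m n) (xs : Fin n → ℝ) : Prop :=
  p + m = Fintype.card (Basic xs) + 1

/-- `y` (workload contributions of the buffers) and `pr` (relative server capacities, `π`):
`y' H = π' B`, i.e. `(y' R)_j = (π' A)_j` for basic `j`, normalized by `π' e = 1`.
Under heavy traffic and complete resource pooling this is a nonsingular square linear system; its
solution is the strictly positive solution of the dual of the static planning problem. -/
def IsWorkloadPair (N : Network p m n) (xs : Fin n → ℝ) (y : Fin m → ℝ) (pr : Fin p → ℝ) : Prop :=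
  (∀ j, 0 < xs j → (y ᵥ* N.inputOutput) j = (pr ᵥ* N.capacityMatrix) j) ∧ ∑ k, pr k = 1

/-! ### Constants of the discrete review policy

Buffer `0 : Fin m` is the one which is allowed to hold work. -/

/-- The policy matrix `Π = [H e₁; B 0]`, where `H` and `B` are the columns of `R` and `A` that belong
to the basic activities. -/
def policyMatrix [NeZero m] (N : Network p m n) (xs : Fin n → ℝ) :
    Matrix (Fin m ⊕ Fin p) (Basic xs ⊕ Unit) ℝ :=
  Matrix.fromBlocks (Matrix.of fun i (j : Basic xs) => N.inputOutput i j)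
    (Matrix.of fun i _ => if i = 0 then 1 else 0)
    (Matrix.of fun k (j : Basic xs) => N.capacityMatrix k j) 0

open Classical in
/-- The (two-sided) inverse of the policy matrix, whose rows and columns carry different index
types. -/
def policyInverse [NeZero m] (N : Network p m n) (xs : Fin n → ℝ) :
    Matrix (Basic xs ⊕ Unit) (Fin m ⊕ Fin p) ℝ :=
  if h : ∃ Q : Matrix (Basic xs ⊕ Unit) (Fin m ⊕ Fin p) ℝ,
      N.policyMatrix xs * Q = 1 ∧ Q * N.policyMatrix xs = 1 then h.choose else 0

/-- The `j`-th entry of `[I, 0] Π⁻¹ [w; c e]`, for a basic activity `j`. -/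
def planEntry [NeZero m] (N : Network p m n) (xs : Fin n → ℝ) (w : Fin m → ℝ) (c : ℝ)
    (j : Basic xs) : ℝ :=
  (N.policyInverse xs *ᵥ Sum.elim w fun _ => c) (Sum.inl j)

/-- `C₀`: the minimum of `x*_j / |(Π⁻¹ eⁱ)_j|` over basic `j` and buffers `i`, where a quotient with
denominator `0` counts as `+∞` (all those with `i` the first buffer do). For `m ≥ 2` some
denominator is nonzero. -/
def constC0 [NeZero m] (N : Network p m n) (xs : Fin n → ℝ) : ℝ :=
  sInf {a | ∃ (j : Basic xs) (i : Fin m), N.policyInverse xs (Sum.inl j) (Sum.inl i) ≠ 0 ∧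
    a = xs j / |N.policyInverse xs (Sum.inl j) (Sum.inl i)|}

/-- `C₁ = C₀ max_j (y_j / y_1)`. -/
def constC1 [NeZero m] (N : Network p m n) (xs : Fin n → ℝ) (y : Fin m → ℝ) : ℝ :=
  N.constC0 xs * ⨆ i, y i / y 0

/-- The common value of the entries of `θ* = n [(2 + C₁ + C₀) (1 ∨ max_j μ_j) + 1] e`. -/
def safetyFactor [NeZero m] (N : Network p m n) (xs : Fin n → ℝ) (y : Fin m → ℝ) : ℝ :=
  n * ((2 + N.constC1 xs y + N.constC0 xs) * max 1 (⨆ j, N.serviceRate j) + 1)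

/-- The admissible range `0 < δ < C₀ / (2 m [1 + (∑ y_i) (max λ_k)])` of the perturbation
constant. -/
def IsPerturbationConstant [NeZero m] (N : Network p m n) (xs : Fin n → ℝ) (y : Fin m → ℝ)
    (δ : ℝ) : Prop :=
  0 < δ ∧ δ < N.constC0 xs / (2 * m * (1 + (∑ i, y i) * ⨆ k, N.arrivalRate k))

/-! ### The plan of a review period in which the contents `q` have been observed -/

/-- `q ∈ B_a(θ)`: `q_1 > θ_1 - a` and `|q_i - θ_i| < a` for the other buffers. -/
def NearTarget [NeZero m] (a : ℝ) (θ q : Fin m → ℝ) : Prop :=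
  θ 0 - a < q 0 ∧ ∀ i, i ≠ 0 → |q i - θ i| < a

/-- Initial idling time `[y'(θ - q)]⁺`. -/
def idleTime (y θ q : Fin m → ℝ) : ℝ := max 0 (y ⬝ᵥ (θ - q))

/-- `q̃ = q + λ [y'(θ - q)]⁺`. -/
def afterIdling (N : Network p m n) (y θ q : Fin m → ℝ) : Fin m → ℝ :=
  q + idleTime y θ q • N.arrivalRate

/-- Stretching coefficient
`C_s = max_{j basic} |(1/l) [I, 0] Π⁻¹ [θ - q̃; 0]|_j / x*_j ∨ 1`. -/
def stretch [NeZero m] (N : Network p m n) (xs : Fin n → ℝ) (y : Fin m → ℝ) (l : ℝ)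
    (θ q : Fin m → ℝ) : ℝ :=
  max 1 (⨆ j : Basic xs, |1 / l * N.planEntry xs (θ - N.afterIdling y θ q) 0 j| / xs j)

open Classical in
/-- Length of the processing part of the period: `l` if `q ∈ B_{δ l}(θ)`, and `C_s l` otherwise. -/
def processingTime [NeZero m] (N : Network p m n) (xs : Fin n → ℝ) (y : Fin m → ℝ) (l δ : ℝ)
    (θ q : Fin m → ℝ) : ℝ :=
  if NearTarget (δ * l) θ q then l else N.stretch xs y l θ q * l

open Classical in
/-- Time planned for activity `j` in the period. If `q ∈ B_{δ l}(θ)` it is `x_j l`, where `x_B l` are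
the first entries of `Π⁻¹ [q + λ T^exe - θ; e l]` and `T^exe = l + [y'(θ - q)]⁺`; otherwise it is
`C_s x_j l` with `x_B = x*_B (1 - 1/C_s) + (1/(C_s l)) [I, 0] Π⁻¹ [q̃ + λ l - θ; e l]`. Nonbasic
activities are not used. -/
def plannedWork [NeZero m] (N : Network p m n) (xs : Fin n → ℝ) (y : Fin m → ℝ) (l δ : ℝ)
    (θ q : Fin m → ℝ) (j : Fin n) : ℝ :=
  if hj : 0 < xs j then
    if NearTarget (δ * l) θ q then
      N.planEntry xs (q + (l + idleTime y θ q) • N.arrivalRate - θ) l ⟨j, hj⟩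
    else
      N.stretch xs y l θ q *
        (xs j * (1 - 1 / N.stretch xs y l θ q) +
          1 / (N.stretch xs y l θ q * l) *
            N.planEntry xs (N.afterIdling y θ q + l • N.arrivalRate - θ) l ⟨j, hj⟩) * l
  else 0

/-- `D` is a schedule of the planned work `w` over a time span of length `L`: up to time `t` the
server of activity `j` is to spend `D t j` time units on it. The order in which, or the rates at
which, a server undertakes its activities is arbitrary, subject to its capacity. -/
def IsSchedule (N : Network p m n) (L : ℝ) (w : Fin n → ℝ) (D : ℝ → Fin n → ℝ) : Prop :=
  D 0 = 0 ∧ D L = w ∧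
  ∀ s t, 0 ≤ s → s ≤ t → t ≤ L →
    (∀ j, D s j ≤ D t j) ∧ ∀ k, (N.capacityMatrix *ᵥ (D t - D s)) k ≤ t - s

end Network

/-! ### Stochastic primitives -/

/-- The stochastic increments of the network: `2 n + m` mutually independent sequences of independent
and identically distributed random variables, `ubar k` and `vbar j` strictly positive with mean
one, and the routing vectors `phi j` with values in `{0, e_1, …, e_m}`. (The first job has
index `0`.) -/
structure Primitives {p m n : ℕ} (N : Network p m n) {Ω : Type*} [MeasurableSpace Ω]
    (P : Measure Ω) where
  ubar : Fin m → ℕ → Ω → ℝ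
  vbar : Fin n → ℕ → Ω → ℝ
  phi : Fin n → ℕ → Ω → Fin m → ℝ
  ubar_measurable : ∀ k i, Measurable (ubar k i)
  vbar_measurable : ∀ j i, Measurable (vbar j i)
  phi_measurable : ∀ j i, Measurable (phi j i)
  ubar_pos : ∀ k i, ∀ᵐ ω ∂P, 0 < ubar k i ω
  vbar_pos : ∀ j i, ∀ᵐ ω ∂P, 0 < vbar j i ω
  phi_mem : ∀ j i, ∀ᵐ ω ∂P, phi j i ω = 0 ∨ ∃ l, phi j i ω = Pi.single l 1
  ubar_ident : ∀ k i, IdentDistrib (ubar k i) (ubar k 0) P P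
  vbar_ident : ∀ j i, IdentDistrib (vbar j i) (vbar j 0) P P
  phi_ident : ∀ j i, IdentDistrib (phi j i) (phi j 0) P P
  ubar_indep : ∀ k, iIndepFun (ubar k) P
  vbar_indep : ∀ j, iIndepFun (vbar j) P
  phi_indep : ∀ j, iIndepFun (phi j) P
  sequences_indep : iIndep
    (Sum.elim (fun k : Fin m => MeasurableSpace.comap (fun ω i => ubar k i ω) inferInstance)
      (Sum.elim (fun j : Fin n => MeasurableSpace.comap (fun ω i => vbar j i ω) inferInstance)
        (fun j : Fin n => MeasurableSpace.comap (fun ω i => phi j i ω) inferInstance))) P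
  ubar_mean : ∀ k, ∫ ω, ubar k 0 ω ∂P = 1
  vbar_mean : ∀ j, ∫ ω, vbar j 0 ω ∂P = 1
  phi_prob : ∀ j l, P.real {ω | phi j 0 ω = Pi.single l 1} = N.routing j l

namespace Primitives

variable {p m n : ℕ} {N : Network p m n} {Ω : Type*} [MeasurableSpace Ω] {P : Measure Ω}

/-- Finite moments of order `2 + 2 ε₁` of the (normalized) interarrival and service times. -/
def MomentAssumption (X : Primitives N P) (ε₁ : ℝ) : Prop :=
  (∀ k, Integrable (fun ω => |X.ubar k 0 ω| ^ (2 + 2 * ε₁)) P) ∧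
    ∀ j, Integrable (fun ω => |X.vbar j 0 ω| ^ (2 + 2 * ε₁)) P

/-- `U_k(l)`, the arrival time of the `l`-th external arrival to buffer `k` (for `λ_k ≠ 0`). -/
def arrivalTime (X : Primitives N P) (ω : Ω) (k : Fin m) (l : ℕ) : ℝ :=
  ∑ i ∈ Finset.range l, X.ubar k i ω / N.arrivalRate k

/-- `V_j(l)`, the total service time of the first `l` jobs of activity `j`. -/
def serviceTime (X : Primitives N P) (ω : Ω) (j : Fin n) (l : ℕ) : ℝ :=
  ∑ i ∈ Finset.range l, N.meanService j * X.vbar j i ω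

/-- `Φ_j(l)`, the cumulative routing vector. -/
def routed (X : Primitives N P) (ω : Ω) (j : Fin n) (l : ℕ) : Fin m → ℝ :=
  ∑ i ∈ Finset.range l, X.phi j i ω

/-- `E_k(t) = max {l : U_k(l) ≤ t}`, and no arrivals if `λ_k = 0`. -/
def arrivals (X : Primitives N P) (ω : Ω) (k : Fin m) (t : ℝ) : ℕ :=
  if N.arrivalRate k = 0 then 0 else sSup {l : ℕ | X.arrivalTime ω k l ≤ t}

/-- `S_j(t) = max {l : V_j(l) ≤ t}`. -/
def completions (X : Primitives N P) (ω : Ω) (j : Fin n) (t : ℝ) : ℕ :=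
  sSup {l : ℕ | X.serviceTime ω j l ≤ t}

/-! ### Dynamics under a cumulative time allocation `T` -/

/-- Buffer contents
`Z(t) = Z(0) + E(t) + ∑_j Φ_j(S_j(T_j(t))) - C S(T(t))`, where `Z(0) = z₀`. -/
def contents (X : Primitives N P) (ω : Ω) (z₀ : Fin m → ℝ) (T : ℝ → Fin n → ℝ) (t : ℝ) :
    Fin m → ℝ :=
  fun i => z₀ i + X.arrivals ω i t +
    ∑ j, X.routed ω j (X.completions ω j (T t j)) i -
    (N.constituencyMatrix *ᵥ fun j => (X.completions ω j (T t j) : ℝ)) i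

/-- The path `T` of cumulative time allocations is admissible. -/
def Admissible (X : Primitives N P) (ω : Ω) (z₀ : Fin m → ℝ) (T : ℝ → Fin n → ℝ) : Prop :=
  T 0 = 0 ∧
  (∀ s t, 0 ≤ s → s ≤ t → (∀ j, T s j ≤ T t j) ∧
    ∀ k, (N.capacityMatrix *ᵥ (T t - T s)) k ≤ t - s) ∧
  ∀ t, 0 ≤ t → ∀ i, 0 ≤ X.contents ω z₀ T t i

/-- The service time that activity `j` may use in a period which starts at time `τ` with contents
`q`, if it may process no more than `q_{b(j)} / n` jobs. -/
def serviceBudget (X : Primitives N P) (ω : Ω) (q : Fin m → ℝ) (T : ℝ → Fin n → ℝ) (τ : ℝ)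
    (j : Fin n) : ℝ :=
  max 0 (X.serviceTime ω j (X.completions ω j (T τ j) + ⌊q (N.buffer j) / n⌋₊) - T τ j)

/-- In the review period that starts at time `τ`, the path `T` follows the discrete review policy
with nominal period length `l`, perturbation constant `δ` and safety stocks `θ`: all servers idle
for `[y'(θ - q)]⁺` time units; then the planned work is undertaken according to some schedule `D`.

* If `q ∈ B_{δ l}(θ)`, activity `j` follows the schedule until `q_{b(j)} / n` jobs have been
  processed by it, and it is idle for the rest of the period.
* Otherwise activity `j` receives no more than the scheduled effort, and none while its buffer is
  empty. It follows the schedule until the buffer has run out of jobs, in the sense that there are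
  fewer jobs than basic activities that share the buffer (for a buffer with a single basic activity:
  it is empty). How a shortage of jobs is divided among several activities, and whether an activity
  is resumed when its buffer has been replenished, is left open. -/
def FollowsPeriod [NeZero m] (X : Primitives N P) (ω : Ω) (xs : Fin n → ℝ) (y : Fin m → ℝ)
    (l δ : ℝ) (θ z₀ : Fin m → ℝ) (T : ℝ → Fin n → ℝ) (τ : ℝ) : Prop :=
  let q := X.contents ω z₀ T τ
  let a := τ + Network.idleTime y θ q
  let L := N.processingTime xs y l δ θ q
  (∀ t, τ ≤ t → t ≤ a → T t = T τ) ∧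
  ∃ D : ℝ → Fin n → ℝ, N.IsSchedule L (N.plannedWork xs y l δ θ q) D ∧
    (Network.NearTarget (δ * l) θ q → ∀ t, 0 ≤ t → t ≤ L → ∀ j,
      T (a + t) j = T τ j + min (D t j) (X.serviceBudget ω q T τ j)) ∧
    (¬ Network.NearTarget (δ * l) θ q → ∀ j,
      (∀ s t, 0 ≤ s → s ≤ t → t ≤ L →
        T (a + t) j - T (a + s) j ≤ D t j - D s j ∧
        ((∀ v, s ≤ v → v < t → X.contents ω z₀ T (a + v) (N.buffer j) < 1) →
          T (a + t) j = T (a + s) j)) ∧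
      ∀ t, 0 ≤ t → t ≤ L →
        (∀ v, 0 ≤ v → v < t →
          (Fintype.card {i : Network.Basic xs // N.buffer i = N.buffer j} : ℝ) ≤
            X.contents ω z₀ T (a + v) (N.buffer j)) →
        T (a + t) j = T τ j + D t j)

/-- `T` follows the discrete review policy, with review points `τ 0 = 0, τ 1, τ 2, …`. -/
def FollowsDiscreteReview [NeZero m] (X : Primitives N P) (ω : Ω) (xs : Fin n → ℝ) (y : Fin m → ℝ)
    (l δ : ℝ) (θ z₀ : Fin m → ℝ) (T : ℝ → Fin n → ℝ) : Prop :=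
  ∃ τ : ℕ → ℝ, τ 0 = 0 ∧
    ∀ k, τ (k + 1) = τ k + Network.idleTime y θ (X.contents ω z₀ T (τ k)) +
        N.processingTime xs y l δ θ (X.contents ω z₀ T (τ k)) ∧
      X.FollowsPeriod ω xs y l δ θ z₀ T (τ k)

end Primitives

/-- Nominal length `l(r) = r^{1 - ε₂}` of the review periods of the `r`-th system. -/
def reviewLength (ε₂ : ℝ) (r : ℕ) : ℝ := (r : ℝ) ^ (1 - ε₂)

/-- Safety stocks `θ(r) = θ* l(r)` of the `r`-th system, which are also its initial contents. -/
def safetyStock {p m n : ℕ} [NeZero m] (N : Network p m n) (xs : Fin n → ℝ) (y : Fin m → ℝ)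
    (ε₂ : ℝ) (r : ℕ) : Fin m → ℝ :=
  fun _ => N.safetyFactor xs y * reviewLength ε₂ r

/-- Diffusion-scaled buffer contents `Ẑ^r(s) = Z^r(r² s) / r` of the `r`-th system under the
allocation `T`. -/
def scaledContents {p m n : ℕ} [NeZero m] {N : Network p m n} {Ω : Type*} [MeasurableSpace Ω]
    {P : Measure Ω} (X : Primitives N P) (xs : Fin n → ℝ) (y : Fin m → ℝ) (ε₂ : ℝ) (r : ℕ)
    (ω : Ω) (T : ℝ → Fin n → ℝ) (s : ℝ) : Fin m → ℝ :=
  fun k => X.contents ω (safetyStock N xs y ε₂ r) T ((r : ℝ) ^ 2 * s) k / r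

end

/-! The policy is self-correcting as long as the primitives behave almost like a fluid on the scale
$l = l(r)$ of one review period. Call a sample path regular if, up to a time of order $r^2$, the
arrivals, the completions and the net outflow of each activity are linear over every span of length
at most $\kappa l$, with an error of at most $\varepsilon l$ (`IsRegular`).

On a regular path every review finds the state near the target, so case 2 never occurs. Idling
brings the workload up to at least that of $\theta$, because work arrives at unit rate; inverting
$\Pi$ then gives a plan whose fluid end state is $\theta + x e_1$ with $x \ge 0$
(`exists_eq_plannedWork`). The safety stocks keep the cap on processed jobs from binding
(`lt_floor_div`), so the plan is carried out in full, and the true end state differs from the fluid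
one by at most $(n+1)\varepsilon l < \delta l$: it is near the target again (`nearTarget_next`).
Between reviews the contents grow by $O(l)$. Hence the buffers other than the designated one stay
below $c\,l(r)$, and $c\,l(r)/r = c\,r^{-\varepsilon_2} \to 0$.

Regularity has probability tending to one (`isRegular_withHighProbability`). A moment of order
$2+2\varepsilon_1$ makes a block of about $l$ summands irregular with probability
$O(l^{-(1+\varepsilon_1)})$; there are $O(r^2/l)$ blocks, and $r^2 l^{-(2+\varepsilon_1)} \to 0$
since $\varepsilon_2 < \varepsilon_1/3$. Monotonicity passes from blocks to all windows, and
inversion passes from sums to counting processes.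

Invertibility of $\Pi$ and positivity of $y$ come from uniqueness of the nominal plan: no
perturbation by basic activities preserves the drift without using more of some server's capacity.
-/

noncomputable section

/-! ### Moments of sums of independent centred random variables -/

/-- Split the power as $(1+s)\,(1+s)^{p/2-1}$ with $1+s = (1+x)^2$. The second exponent lies in
$[0,1]$, so Bernoulli's inequality for concave powers applies, and $11 = 2 + 3^2$ bounds $p/2 +
(p/2-1)(2+x)^2$. The linear coefficient has to be exactly $p$: that term will be cancelled by
centring. -/
theorem abs_one_add_rpow_le {p x : ℝ} (hp2 : 2 ≤ p) (hp4 : p ≤ 4) (hx : |x| ≤ 1) :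
    |1 + x| ^ p ≤ 1 + p * x + 11 * x ^ 2 := by
  obtain ⟨hx1, hx2⟩ := abs_le.1 hx
  have h0 : (0 : ℝ) ≤ 1 + (2 * x + x ^ 2) := by nlinarith [sq_nonneg (1 + x)]
  have e1 : |1 + x| ^ p = (1 + (2 * x + x ^ 2)) ^ (1 + (p / 2 - 1)) := by
    have : 1 + (2 * x + x ^ 2) = |1 + x| ^ (2 : ℝ) := by
      rw [Real.rpow_two, sq_abs]; ring
    rw [this, ← Real.rpow_mul (abs_nonneg _)]
    congr 1; ring
  rw [e1, Real.rpow_add' h0 (by linarith), Real.rpow_one]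
  have hb := rpow_one_add_le_one_add_mul_self (s := 2 * x + x ^ 2)
    (by nlinarith [sq_nonneg (1 + x)]) (p := p / 2 - 1) (by linarith) (by linarith)
  calc (1 + (2 * x + x ^ 2)) * (1 + (2 * x + x ^ 2)) ^ (p / 2 - 1)
      ≤ (1 + (2 * x + x ^ 2)) * (1 + (p / 2 - 1) * (2 * x + x ^ 2)) :=
        mul_le_mul_of_nonneg_left hb h0
    _ = 1 + p * x + (p / 2 * x ^ 2 + (p / 2 - 1) * (2 + x) ^ 2 * x ^ 2) := by ring
    _ ≤ 1 + p * x + 11 * x ^ 2 := by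
        have : p / 2 + (p / 2 - 1) * (2 + x) ^ 2 ≤ 11 := by nlinarith
        nlinarith [sq_nonneg x]

/-- If $|b| \le |a|$, this is the previous bound scaled by $|a|^p$. If $|a| < |b|$, the left side is
at most $16|b|^p$ and the linear term at least $-4|b|^p$, whence the constant $20$. -/
theorem abs_add_rpow_le {p : ℝ} (hp2 : 2 ≤ p) (hp4 : p ≤ 4) (a b : ℝ) :
    |a + b| ^ p ≤
      |a| ^ p + p * ((a * |a| ^ (p - 2)) * b) + 11 * (|a| ^ (p - 2) * b ^ 2) + 20 * |b| ^ p := by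
  have hA : 0 ≤ |a| ^ (p - 2) := by positivity
  have hAp : 0 ≤ |a| ^ p := by positivity
  have hBp : 0 ≤ |b| ^ p := by positivity
  rcases lt_or_ge |a| |b| with hab | hab
  · have hb0 : 0 < |b| := (abs_nonneg a).trans_lt hab
    have h1 : |a + b| ^ p ≤ 16 * |b| ^ p := by
      calc |a + b| ^ p ≤ (2 * |b|) ^ p := by
            apply Real.rpow_le_rpow (abs_nonneg _) _ (by linarith)
            linarith [abs_add_le a b]
        _ = 2 ^ p * |b| ^ p := Real.mul_rpow (by norm_num) (abs_nonneg _)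
        _ ≤ 2 ^ (4 : ℝ) * |b| ^ p := by
            apply mul_le_mul_of_nonneg_right _ hBp
            exact Real.rpow_le_rpow_of_exponent_le (by norm_num) hp4
        _ = 16 * |b| ^ p := by norm_num
    have h2 : |(a * |a| ^ (p - 2)) * b| ≤ |b| ^ p := by
      rw [abs_mul, abs_mul, abs_of_nonneg hA]
      have h3 : |a| ^ (p - 2) ≤ |b| ^ (p - 2) :=
        Real.rpow_le_rpow (abs_nonneg _) hab.le (by linarith)
      have h4 : |b| ^ p = |b| * |b| ^ (p - 2) * |b| := by
        have : |b| ^ p = |b| ^ (p - 2 + 2) := by congr 1; ring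
        rw [this, Real.rpow_add hb0, Real.rpow_two]; ring
      rw [h4]
      gcongr
    have h5 := (abs_le.1 h2).1
    have h6 : 0 ≤ |a| ^ (p - 2) * b ^ 2 := by positivity
    nlinarith
  · rcases eq_or_ne a 0 with rfl | ha
    · have hb : b = 0 := by simpa using hab
      subst hb
      have : (0 : ℝ) ^ p = 0 := Real.zero_rpow (by linarith)
      simp [this]
    · have ha0 : 0 < |a| := abs_pos.2 ha
      have hx : |b / a| ≤ 1 := by rw [abs_div]; exact (div_le_one ha0).2 hab
      have h4 : |a| ^ p = |a| ^ (p - 2) * a ^ 2 := by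
        have : |a| ^ p = |a| ^ (p - 2 + 2) := by congr 1; ring
        rw [this, Real.rpow_add ha0, Real.rpow_two, sq_abs]
      have e : |a + b| ^ p = |a| ^ p * |1 + b / a| ^ p := by
        rw [← Real.mul_rpow (abs_nonneg _) (abs_nonneg _), ← abs_mul]
        congr 2; field_simp
      calc |a + b| ^ p = |a| ^ p * |1 + b / a| ^ p := e
        _ ≤ |a| ^ p * (1 + p * (b / a) + 11 * (b / a) ^ 2) :=
            mul_le_mul_of_nonneg_left (abs_one_add_rpow_le hp2 hp4 hx) hAp
        _ = |a| ^ p + p * ((a * |a| ^ (p - 2)) * b) + 11 * (|a| ^ (p - 2) * b ^ 2) := by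
            rw [h4]; field_simp
        _ ≤ _ := by linarith

section Moments

variable {Ω : Type*} [MeasurableSpace Ω] {P : Measure Ω}

theorem integrable_abs_rpow_of_le [IsProbabilityMeasure P] {f : Ω → ℝ} {p q : ℝ} (hf : Measurable f) (hq : 0 ≤ q)
    (hqp : q ≤ p) (hint : Integrable (fun ω => |f ω| ^ p) P) :
    Integrable (fun ω => |f ω| ^ q) P := by
  refine ((integrable_const (1 : ℝ)).add hint).mono' (by fun_prop) (ae_of_all _ fun ω => ?_)
  rw [Real.norm_of_nonneg (by positivity)]
  simp only [Pi.add_apply]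
  have h0 : 0 ≤ |f ω| ^ p := by positivity
  rcases le_total |f ω| 1 with h | h
  · linarith [Real.rpow_le_one (abs_nonneg (f ω)) h hq]
  · linarith [Real.rpow_le_rpow_of_exponent_le h hqp]

theorem integrable_abs_add_rpow {f g : Ω → ℝ} {p : ℝ} (hf : Measurable f) (hg : Measurable g)
    (hp : 0 ≤ p) (hfi : Integrable (fun ω => |f ω| ^ p) P)
    (hgi : Integrable (fun ω => |g ω| ^ p) P) :
    Integrable (fun ω => |f ω + g ω| ^ p) P := by
  refine ((hfi.add hgi).const_mul (2 ^ p)).mono' (by fun_prop) (ae_of_all _ fun ω => ?_)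
  rw [Real.norm_of_nonneg (by positivity)]
  simp only [Pi.add_apply]
  have h1 : |f ω + g ω| ≤ 2 * max |f ω| |g ω| := by
    have := abs_add_le (f ω) (g ω)
    linarith [le_max_left |f ω| |g ω|, le_max_right |f ω| |g ω|]
  calc |f ω + g ω| ^ p ≤ (2 * max |f ω| |g ω|) ^ p :=
        Real.rpow_le_rpow (abs_nonneg _) h1 hp
    _ = 2 ^ p * (max |f ω| |g ω|) ^ p := Real.mul_rpow (by norm_num) (by positivity)
    _ ≤ 2 ^ p * (|f ω| ^ p + |g ω| ^ p) := by
        gcongr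
        have h2 : 0 ≤ |f ω| ^ p := by positivity
        have h3 : 0 ≤ |g ω| ^ p := by positivity
        rcases max_choice |f ω| |g ω| with h | h <;> rw [h] <;> linarith

variable {ι : Type*} [DecidableEq ι] {Y : ι → Ω → ℝ}

theorem integrable_abs_sum_rpow {p : ℝ} (hp : 0 < p) (hmeas : ∀ i, Measurable (Y i))
    (hint : ∀ i, Integrable (fun ω => |Y i ω| ^ p) P) (s : Finset ι) :
    Integrable (fun ω => |∑ i ∈ s, Y i ω| ^ p) P := by
  induction s using Finset.induction_on with
  | empty => simp [Real.zero_rpow hp.ne']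
  | insert i s hi ih =>
    simp only [Finset.sum_insert hi]
    exact integrable_abs_add_rpow (hmeas i) (by fun_prop) hp.le (hint i) ih

variable [IsProbabilityMeasure P]

theorem integral_sq_sum_le {V : ℝ} (hmeas : ∀ i, Measurable (Y i)) (hind : iIndepFun Y P)
    (hmean : ∀ i, ∫ ω, Y i ω ∂P = 0) (hint : ∀ i, Integrable (fun ω => |Y i ω| ^ (2 : ℝ)) P)
    (hV : ∀ i, ∫ ω, Y i ω ^ 2 ∂P ≤ V) (s : Finset ι) :
    ∫ ω, (∑ i ∈ s, Y i ω) ^ 2 ∂P ≤ s.card * V := by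
  induction s using Finset.induction_on with
  | empty => simp
  | insert i s hi ih =>
    have hS : Measurable fun ω => ∑ j ∈ s, Y j ω := by fun_prop
    have hSi := integrable_abs_sum_rpow two_pos hmeas hint s
    have hS1 : Integrable (fun ω => ∑ j ∈ s, Y j ω) P := by
      have := integrable_abs_rpow_of_le (q := 1) hS (by norm_num) (by norm_num) hSi
      simp only [Real.rpow_one] at this
      exact (integrable_norm_iff hS.aestronglyMeasurable).1 this
    have hY1 : Integrable (Y i) P := by
      have := integrable_abs_rpow_of_le (q := 1) (hmeas i) (by norm_num) (by norm_num) (hint i)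
      simp only [Real.rpow_one] at this
      exact (integrable_norm_iff (hmeas i).aestronglyMeasurable).1 this
    have hindep : IndepFun (fun ω => ∑ j ∈ s, Y j ω) (Y i) P := by
      have := hind.indepFun_finsetSum_of_notMem hmeas hi
      convert this using 1
      ext ω; simp
    have hprod : Integrable (fun ω => (∑ j ∈ s, Y j ω) * Y i ω) P := hindep.integrable_mul hS1 hY1
    have hprod0 : ∫ ω, (∑ j ∈ s, Y j ω) * Y i ω ∂P = 0 := by
      rw [hindep.integral_fun_mul_eq_mul_integral hS1.1 hY1.1, hmean i, mul_zero]
    have hSq : Integrable (fun ω => (∑ j ∈ s, Y j ω) ^ 2) P := by simpa using hSi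
    have hYq : Integrable (fun ω => Y i ω ^ 2) P := by simpa using hint i
    have e : ∀ ω, (∑ j ∈ insert i s, Y j ω) ^ 2
        = (∑ j ∈ s, Y j ω) ^ 2 + 2 * ((∑ j ∈ s, Y j ω) * Y i ω) + Y i ω ^ 2 := by
      intro ω; rw [Finset.sum_insert hi]; ring
    simp_rw [e]
    have hI : Integrable (fun ω => (∑ j ∈ s, Y j ω) ^ 2 + 2 * ((∑ j ∈ s, Y j ω) * Y i ω)) P :=
      hSq.add (hprod.const_mul 2)
    rw [integral_add hI hYq, integral_add hSq (hprod.const_mul 2),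
      integral_const_mul, hprod0, Finset.card_insert_of_notMem hi]
    push_cast
    linarith [hV i]

/-- A Rosenthal-type bound of order (number of terms)$^{p/2}$, by adding one summand at a time. The
linear term of `abs_add_rpow_le` has mean zero by independence, and the quadratic one needs only
$\mathbf E|S|^{p-2}$, which the variance controls because $p-2 \le 2$. -/
theorem integral_abs_sum_rpow_le {p V M : ℝ} (hp2 : 2 ≤ p) (hp4 : p ≤ 4)
    (hmeas : ∀ i, Measurable (Y i)) (hind : iIndepFun Y P)
    (hmean : ∀ i, ∫ ω, Y i ω ∂P = 0) (hint : ∀ i, Integrable (fun ω => |Y i ω| ^ p) P)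
    (hV0 : 0 ≤ V) (hV : ∀ i, ∫ ω, Y i ω ^ 2 ∂P ≤ V)
    (hM0 : 0 ≤ M) (hM : ∀ i, ∫ ω, |Y i ω| ^ p ∂P ≤ M) (s : Finset ι) :
    ∫ ω, |∑ i ∈ s, Y i ω| ^ p ∂P ≤
      (11 * ((1 + V) * V) + 20 * M) * (s.card * (s.card : ℝ) ^ (p / 2 - 1)) := by
  have hint2 : ∀ i, Integrable (fun ω => |Y i ω| ^ (2 : ℝ)) P := fun i =>
    integrable_abs_rpow_of_le (hmeas i) (by norm_num) hp2 (hint i)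
  induction s using Finset.induction_on with
  | empty => simp [Real.zero_rpow (show p ≠ 0 by linarith)]
  | insert i s hi ih =>
    set S : Ω → ℝ := fun ω => ∑ j ∈ s, Y j ω with hSdef
    have hS : Measurable S := by fun_prop
    have hSp : Integrable (fun ω => |S ω| ^ p) P :=
      integrable_abs_sum_rpow (by linarith) hmeas hint s
    have hSq : Integrable (fun ω => |S ω| ^ (p - 2)) P :=
      integrable_abs_rpow_of_le hS (by linarith) (by linarith) hSp
    have hS2 : Integrable (fun ω => S ω ^ 2) P := by
      simpa using integrable_abs_sum_rpow two_pos hmeas hint2 s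
    have hSs : Integrable (fun ω => S ω * |S ω| ^ (p - 2)) P := by
      refine (integrable_abs_rpow_of_le (q := p - 1) hS (by linarith) (by linarith) hSp).mono'
        (by fun_prop) (ae_of_all _ fun ω => ?_)
      rw [norm_mul, Real.norm_eq_abs, Real.norm_of_nonneg (by positivity)]
      have : |S ω| ^ (p - 1) = |S ω| ^ (1 + (p - 2)) := by congr 1; ring
      rw [this, Real.rpow_add' (abs_nonneg _) (by linarith), Real.rpow_one]
    have hY1 : Integrable (Y i) P := by
      have := integrable_abs_rpow_of_le (q := 1) (hmeas i) (by norm_num) (by norm_num) (hint2 i)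
      simp only [Real.rpow_one] at this
      exact (integrable_norm_iff (hmeas i).aestronglyMeasurable).1 this
    have hY2 : Integrable (fun ω => Y i ω ^ 2) P := by simpa using hint2 i
    have hindep : IndepFun S (Y i) P := by
      have := hind.indepFun_finsetSum_of_notMem hmeas hi
      convert this using 1
      ext ω; simp [hSdef]
    have hi1 : IndepFun (fun ω => S ω * |S ω| ^ (p - 2)) (Y i) P :=
      hindep.comp (φ := fun x => x * |x| ^ (p - 2)) (ψ := id) (by fun_prop) measurable_id
    have hi2 : IndepFun (fun ω => |S ω| ^ (p - 2)) (fun ω => Y i ω ^ 2) P :=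
      hindep.comp (φ := fun x => |x| ^ (p - 2)) (ψ := fun x => x ^ 2) (by fun_prop) (by fun_prop)
    have hp1 : Integrable (fun ω => (S ω * |S ω| ^ (p - 2)) * Y i ω) P := hi1.integrable_mul hSs hY1
    have hp2' : Integrable (fun ω => |S ω| ^ (p - 2) * Y i ω ^ 2) P := hi2.integrable_mul hSq hY2
    have hz : ∫ ω, (S ω * |S ω| ^ (p - 2)) * Y i ω ∂P = 0 := by
      rw [hi1.integral_fun_mul_eq_mul_integral hSs.1 hY1.1, hmean i, mul_zero]
    have hw : ∫ ω, |S ω| ^ (p - 2) * Y i ω ^ 2 ∂P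
        = (∫ ω, |S ω| ^ (p - 2) ∂P) * ∫ ω, Y i ω ^ 2 ∂P :=
      hi2.integral_fun_mul_eq_mul_integral hSq.1 hY2.1
    set c : ℝ := (s.card : ℝ) with hc
    have hc0 : 0 ≤ c := by positivity
    set e : ℝ := p / 2 - 1 with he
    have he0 : 0 ≤ e := by linarith
    have he1 : e ≤ 1 := by linarith
    have hNe : (1 : ℝ) ≤ (c + 1) ^ e := Real.one_le_rpow (by linarith) he0
    have hmid : ∫ ω, |S ω| ^ (p - 2) ∂P ≤ (c + 1) ^ e * (1 + V) := by
      -- This is $u^e \le 1 + u$ for $u = S^2/(c+1)$ and $0 \le e \le 1$; normalizing by $c+1$ makes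
      -- the mean of $u$ at most $V$.
      have hpt : ∀ ω, |S ω| ^ (p - 2) ≤ (c + 1) ^ e * (1 + S ω ^ 2 / (c + 1)) := by
        intro ω
        have h1 : |S ω| ^ (p - 2) = (c + 1) ^ e * (S ω ^ 2 / (c + 1)) ^ e := by
          rw [← Real.mul_rpow (by positivity) (by positivity),
            mul_div_cancel₀ _ (by positivity : c + 1 ≠ 0), ← sq_abs, ← Real.rpow_two,
            ← Real.rpow_mul (abs_nonneg _)]
          congr 1; rw [he]; ring
        rw [h1]
        gcongr
        have h2 : 0 ≤ S ω ^ 2 / (c + 1) := by positivity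
        rcases le_total (S ω ^ 2 / (c + 1)) 1 with h | h
        · linarith [Real.rpow_le_one h2 h he0]
        · have := Real.rpow_le_rpow_of_exponent_le h he1
          rw [Real.rpow_one] at this
          linarith
      have hS2le : ∫ ω, S ω ^ 2 ∂P ≤ c * V := integral_sq_sum_le hmeas hind hmean hint2 hV s
      calc ∫ ω, |S ω| ^ (p - 2) ∂P ≤ ∫ ω, (c + 1) ^ e * (1 + S ω ^ 2 / (c + 1)) ∂P :=
            integral_mono hSq
              (((integrable_const _).add (hS2.div_const _)).const_mul _) hpt
        _ = (c + 1) ^ e * (1 + (∫ ω, S ω ^ 2 ∂P) / (c + 1)) := by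
            rw [integral_const_mul, integral_add (integrable_const _) (hS2.div_const _),
              integral_div]
            simp
        _ ≤ (c + 1) ^ e * (1 + V) := by
            gcongr
            rw [div_le_iff₀ (by positivity)]
            nlinarith
    have hstep : ∫ ω, |∑ j ∈ insert i s, Y j ω| ^ p ∂P ≤
        (∫ ω, |S ω| ^ p ∂P) + 11 * ((c + 1) ^ e * (1 + V) * V) + 20 * M := by
      have hpt : ∀ ω, |∑ j ∈ insert i s, Y j ω| ^ p ≤ |S ω| ^ p
          + p * ((S ω * |S ω| ^ (p - 2)) * Y i ω) + 11 * (|S ω| ^ (p - 2) * Y i ω ^ 2)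
          + 20 * |Y i ω| ^ p := by
        intro ω
        rw [Finset.sum_insert hi, add_comm]
        exact abs_add_rpow_le hp2 hp4 _ _
      have hI1 : Integrable (fun ω => |S ω| ^ p
          + p * ((S ω * |S ω| ^ (p - 2)) * Y i ω)) P := hSp.add (hp1.const_mul p)
      have hI2 : Integrable (fun ω => |S ω| ^ p
          + p * ((S ω * |S ω| ^ (p - 2)) * Y i ω) + 11 * (|S ω| ^ (p - 2) * Y i ω ^ 2)) P :=
        hI1.add (hp2'.const_mul 11)
      refine (integral_mono (integrable_abs_sum_rpow (by linarith) hmeas hint _)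
        (hI2.add ((hint i).const_mul 20)) hpt).trans ?_
      simp only [Pi.add_apply]
      rw [integral_add hI2 ((hint i).const_mul 20), integral_add hI1 (hp2'.const_mul 11),
        integral_add hSp (hp1.const_mul p), integral_const_mul, integral_const_mul,
        integral_const_mul, hz, hw]
      have hV' : 0 ≤ ∫ ω, Y i ω ^ 2 ∂P := integral_nonneg fun ω => sq_nonneg _
      have h1 : (∫ ω, |S ω| ^ (p - 2) ∂P) * ∫ ω, Y i ω ^ 2 ∂P ≤ (c + 1) ^ e * (1 + V) * V :=
        mul_le_mul hmid (hV i) hV' (by positivity)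
      linarith [hM i]
    rw [Finset.card_insert_of_notMem hi]
    push_cast
    rw [← hc]
    have hmono : c ^ e ≤ (c + 1) ^ e := Real.rpow_le_rpow hc0 (by linarith) he0
    calc ∫ ω, |∑ j ∈ insert i s, Y j ω| ^ p ∂P
        ≤ (11 * ((1 + V) * V) + 20 * M) * (c * c ^ e) + 11 * ((c + 1) ^ e * (1 + V) * V)
          + 20 * M := by linarith
      _ ≤ (11 * ((1 + V) * V) + 20 * M) * (c * (c + 1) ^ e) + 11 * ((c + 1) ^ e * (1 + V) * V)
          + 20 * M * (c + 1) ^ e := by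
          refine add_le_add (add_le_add ?_ le_rfl) (le_mul_of_one_le_right (by positivity) hNe)
          gcongr
      _ = (11 * ((1 + V) * V) + 20 * M) * ((c + 1) * (c + 1) ^ e) := by ring

/-- Markov's inequality of order `p` for a centred sum of independent random variables. -/
theorem measure_abs_sum_ge_le {p V M η : ℝ} (hp2 : 2 ≤ p) (hp4 : p ≤ 4)
    (hmeas : ∀ i, Measurable (Y i)) (hind : iIndepFun Y P)
    (hmean : ∀ i, ∫ ω, Y i ω ∂P = 0) (hint : ∀ i, Integrable (fun ω => |Y i ω| ^ p) P)
    (hV0 : 0 ≤ V) (hV : ∀ i, ∫ ω, Y i ω ^ 2 ∂P ≤ V)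
    (hM0 : 0 ≤ M) (hM : ∀ i, ∫ ω, |Y i ω| ^ p ∂P ≤ M) (hη : 0 < η) {s : Finset ι}
    (hs : s.Nonempty) :
    P {ω | η * s.card ≤ |∑ i ∈ s, Y i ω|} ≤
      ENNReal.ofReal ((11 * ((1 + V) * V) + 20 * M) / η ^ p * (s.card : ℝ) ^ (-(p / 2))) := by
  have hc : (0 : ℝ) < s.card := by exact_mod_cast hs.card_pos
  have h := mul_meas_ge_le_integral_of_nonneg (μ := P)
    (f := fun ω => |∑ i ∈ s, Y i ω| ^ p) (ae_of_all _ fun ω => by positivity)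
    (integrable_abs_sum_rpow (by linarith) hmeas hint s) ((η * s.card) ^ p)
  have hset : {ω | (η * s.card) ^ p ≤ |∑ i ∈ s, Y i ω| ^ p}
      = {ω | η * s.card ≤ |∑ i ∈ s, Y i ω|} := by
    ext ω
    exact Real.rpow_le_rpow_iff (by positivity) (abs_nonneg _) (by linarith)
  rw [hset] at h
  have h2 := h.trans (integral_abs_sum_rpow_le hp2 hp4 hmeas hind hmean hint hV0 hV hM0 hM s)
  rw [← ofReal_measureReal]
  apply ENNReal.ofReal_le_ofReal
  rw [Real.mul_rpow hη.le hc.le] at h2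
  have hcp : (0 : ℝ) < (s.card : ℝ) ^ p := by positivity
  have hηp : (0 : ℝ) < η ^ p := by positivity
  have e1 : (s.card : ℝ) * (s.card : ℝ) ^ (p / 2 - 1)
      = (s.card : ℝ) ^ (-(p / 2)) * (s.card : ℝ) ^ p := by
    rw [← Real.rpow_add hc]
    conv_lhs => rw [← Real.rpow_one (s.card : ℝ)]
    rw [← Real.rpow_mul hc.le, ← Real.rpow_add hc]
    congr 1; ring
  rw [e1] at h2
  rw [div_mul_eq_mul_div, le_div_iff₀ hηp]
  refine le_of_mul_le_mul_right ?_ hcp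
  linarith

end Moments

/-! ### Events of asymptotically full probability -/

/-- The events `{ω | Q r ω}` have (outer) probability tending to one as `r → ∞`. -/
def WithHighProbability {Ω : Type*} [MeasurableSpace Ω] (P : Measure Ω) (Q : ℕ → Ω → Prop) : Prop :=
  Tendsto (fun r => P {ω | ¬ Q r ω}) atTop (𝓝 0)

namespace WithHighProbability

variable {Ω : Type*} [MeasurableSpace Ω] {P : Measure Ω} {Q Q' : ℕ → Ω → Prop}

theorem mono (h : WithHighProbability P Q) (hQ : ∀ᶠ r in atTop, ∀ᵐ ω ∂P, Q r ω → Q' r ω) :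
    WithHighProbability P Q' := by
  refine tendsto_of_tendsto_of_tendsto_of_le_of_le' tendsto_const_nhds h
    (Eventually.of_forall fun _ => zero_le) ?_
  filter_upwards [hQ] with r hr
  apply measure_mono_ae
  filter_upwards [hr] with ω hω h1 h2
  exact h1 (hω h2)

theorem and (h : WithHighProbability P Q) (h' : WithHighProbability P Q') :
    WithHighProbability P fun r ω => Q r ω ∧ Q' r ω := by
  have hs := Tendsto.add h h'
  rw [add_zero] at hs
  refine tendsto_of_tendsto_of_tendsto_of_le_of_le tendsto_const_nhds hs
    (fun _ => zero_le) fun r => ?_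
  refine (measure_mono ?_).trans (measure_union_le _ _)
  intro ω hω
  simp only [Set.mem_ofPred_eq, not_and_or] at hω
  exact hω

theorem of_eventually_ae (h : ∀ᶠ r in atTop, ∀ᵐ ω ∂P, Q r ω) : WithHighProbability P Q := by
  refine tendsto_const_nhds.congr' ?_
  filter_upwards [h] with r hr
  exact (ae_iff.1 hr).symm

theorem forall_mem {ι : Type*} (s : Finset ι) {Q : ι → ℕ → Ω → Prop}
    (h : ∀ i, WithHighProbability P (Q i)) :
    WithHighProbability P fun r ω => ∀ i ∈ s, Q i r ω := by
  classical
  induction s using Finset.induction_on with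
  | empty => exact of_eventually_ae (Eventually.of_forall fun r => ae_of_all _ fun ω => by simp)
  | insert i s hi ih =>
    refine ((h i).and ih).mono (Eventually.of_forall fun r => ae_of_all _ fun ω hω => ?_)
    simpa using hω

theorem forall_fintype {ι : Type*} [Fintype ι] {Q : ι → ℕ → Ω → Prop}
    (h : ∀ i, WithHighProbability P (Q i)) :
    WithHighProbability P fun r ω => ∀ i, Q i r ω := by
  simpa using forall_mem Finset.univ h

end WithHighProbability

/-! ### The length of the review periods -/

theorem reviewLength_nonneg (ε : ℝ) (r : ℕ) : 0 ≤ reviewLength ε r := by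
  unfold reviewLength; positivity

theorem tendsto_reviewLength {ε : ℝ} (hε : ε < 1) :
    Tendsto (fun r : ℕ => reviewLength ε r) atTop atTop :=
  (tendsto_rpow_atTop (by linarith)).comp tendsto_natCast_atTop_atTop

theorem reviewLength_le_sq {ε : ℝ} (hε : 0 ≤ ε) {r : ℕ} (hr : 1 ≤ r) :
    reviewLength ε r ≤ (r : ℝ) ^ 2 := by
  have h1 : (1 : ℝ) ≤ r := by exact_mod_cast hr
  calc reviewLength ε r ≤ (r : ℝ) ^ (2 : ℝ) :=
        Real.rpow_le_rpow_of_exponent_le h1 (by linarith)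
    _ = _ := Real.rpow_two _

theorem tendsto_reviewLength_div {ε : ℝ} (hε : 0 < ε) (C : ℝ) :
    Tendsto (fun r : ℕ => C * reviewLength ε r / r) atTop (𝓝 0) := by
  have h := ((tendsto_rpow_neg_atTop hε).comp tendsto_natCast_atTop_atTop).const_mul C
  rw [mul_zero] at h
  refine h.congr' ?_
  filter_upwards [eventually_gt_atTop 0] with r hr
  have hr' : (0 : ℝ) < r := by exact_mod_cast hr
  simp only [Function.comp_apply, reviewLength]
  rw [mul_div_assoc]
  congr 1
  conv_rhs => rw [← Real.rpow_one (r : ℝ)]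
  rw [← Real.rpow_mul hr'.le, one_mul, ← Real.rpow_sub hr']
  congr 1; ring

/-- The union bound over $r^2/l$ blocks, each failing with probability of order
$l^{-(1+\varepsilon_1)}$. The exponent of $r$ is $-(\varepsilon_1 - 2\varepsilon_2 -
\varepsilon_1\varepsilon_2)$, and the bracket exceeds $\varepsilon_1(1-\varepsilon_1)/3 > 0$. -/
theorem tendsto_sq_mul_reviewLength_rpow {ε₁ ε₂ : ℝ} (hε₁ : 0 < ε₁) (hε₁' : ε₁ < 1) (hε₂ : 0 < ε₂)
    (hε₂' : ε₂ < ε₁ / 3) (C : ℝ) :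
    Tendsto (fun r : ℕ => C * ((r : ℝ) ^ 2 * reviewLength ε₂ r ^ (-(2 + ε₁)))) atTop (𝓝 0) := by
  have hpos : 0 < ε₁ - 2 * ε₂ - ε₁ * ε₂ := by nlinarith
  have h := ((tendsto_rpow_neg_atTop hpos).comp tendsto_natCast_atTop_atTop).const_mul C
  rw [mul_zero] at h
  refine h.congr' ?_
  filter_upwards [eventually_gt_atTop 0] with r hr
  have hr' : (0 : ℝ) < r := by exact_mod_cast hr
  simp only [Function.comp_apply, reviewLength]
  rw [← Real.rpow_two, ← Real.rpow_mul hr'.le, ← Real.rpow_add hr']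
  congr 2; ring

/-! ### Partial sums over windows -/

/-- If the increments of a nondecreasing sequence over the blocks of a grid are nearly linear, then
so are its increments over all windows. -/
theorem abs_window_sub_le {G : ℕ → ℝ} (hG : Monotone G) {c η N : ℝ} (hc : 0 ≤ c) (hη : 0 ≤ η)
    {h : ℕ} (hh : 0 < h)
    (hblock : ∀ k : ℕ, (k * h : ℝ) ≤ N → |G ((k + 1) * h) - G (k * h) - c * h| ≤ η * h)
    {a d : ℕ} (had : ((a + d : ℕ) : ℝ) ≤ N) :
    |G (a + d) - G a - c * d| ≤ 2 * c * h + η * (d + 2 * h) := by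
  -- Block errors add up. The slack $h$ is there because only the starting point of the last block
  -- has to be at most $N$.
  have hsum : ∀ k j : ℕ, ((k + j : ℕ) : ℝ) * h ≤ N + h →
      |G ((k + j) * h) - G (k * h) - c * (j * h)| ≤ η * (j * h) := by
    intro k j
    induction j with
    | zero => intro _; simp
    | succ j ih =>
      intro hj
      push_cast at hj
      have hh0 : (0 : ℝ) ≤ h := by positivity
      have h1 := ih (by push_cast; nlinarith)
      have h2 := hblock (k + j) (by push_cast; linarith)
      have e : G ((k + (j + 1)) * h) = G ((k + j + 1) * h) := rfl
      rw [e]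
      rw [abs_le] at h1 h2 ⊢
      push_cast
      constructor <;> linarith [h1.1, h1.2, h2.1, h2.2]
  have hh' : (0 : ℝ) < h := by exact_mod_cast hh
  obtain ⟨j, hj⟩ : ∃ j, (a + d) / h = a / h + j :=
    Nat.exists_eq_add_of_le (Nat.div_le_div_right (Nat.le_add_right a d))
  set k := a / h with hk
  have ha1 : k * h ≤ a := Nat.div_mul_le_self a h
  have ha2 : a < (k + 1) * h := by rw [mul_comm]; exact Nat.lt_mul_div_succ a hh
  have hb1 : (k + j) * h ≤ a + d := by rw [← hj]; exact Nat.div_mul_le_self _ h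
  have hb2 : a + d < (k + j + 1) * h := by
    rw [← hj, mul_comm]; exact Nat.lt_mul_div_succ _ hh
  have ra1 : (k : ℝ) * h ≤ a := by exact_mod_cast ha1
  have ra2 : (a : ℝ) < (k + 1) * h := by exact_mod_cast ha2
  have rb1 : ((k : ℝ) + j) * h ≤ a + d := by exact_mod_cast hb1
  have rb2 : (a : ℝ) + d < (k + j + 1) * h := by exact_mod_cast hb2
  push_cast at had
  have hup := (abs_le.1 (hsum k (j + 1) (by push_cast; linarith))).2
  have g1 : G (a + d) ≤ G ((k + (j + 1)) * h) := hG hb2.le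
  have g2 : G (k * h) ≤ G a := hG ha1
  push_cast at hup
  have d0 : (0 : ℝ) ≤ d := by positivity
  rw [abs_le]
  constructor
  -- The lower bound uses the blocks inside the window. If both endpoints lie in one block, then $d
  -- \le h$ and monotonicity alone suffices.
  · rcases Nat.eq_zero_or_pos j with rfl | hj0
    · have g3 : G a ≤ G (a + d) := hG (Nat.le_add_right _ _)
      have : (d : ℝ) ≤ h := by push_cast at rb2; linarith
      nlinarith [mul_nonneg hc hh'.le, mul_nonneg hη d0, mul_nonneg hη hh'.le]
    · obtain ⟨i, rfl⟩ : ∃ i, j = i + 1 := ⟨j - 1, by omega⟩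
      have e : k + (i + 1) = k + 1 + i := by ring
      have hlo := (abs_le.1 (hsum (k + 1) i (by push_cast at rb1 ⊢; linarith))).1
      have g3 : G ((k + 1 + i) * h) ≤ G (a + d) := hG (by rw [← e]; exact hb1)
      have g4 : G a ≤ G ((k + 1) * h) := hG ha2.le
      push_cast at rb1 rb2
      have i1 : (i : ℝ) * h ≤ d := by linarith
      have i2 : (d : ℝ) - 2 * h ≤ i * h := by linarith
      nlinarith [mul_le_mul_of_nonneg_left i1 hη, mul_le_mul_of_nonneg_left i2 hc,
        mul_nonneg hη hh'.le]
  · have i1 : ((j : ℝ) + 1) * h ≤ d + 2 * h := by linarith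
    nlinarith [mul_le_mul_of_nonneg_left i1 hη, mul_le_mul_of_nonneg_left i1 hc]

/-- A sequence of independent and identically distributed nonnegative random variables with mean
`c` and a finite moment of order `p`. -/
structure IsIIDNonneg {Ω : Type*} [MeasurableSpace Ω] (P : Measure Ω) (Y : ℕ → Ω → ℝ) (c p : ℝ) :
    Prop where
  measurable : ∀ i, Measurable (Y i)
  indep : iIndepFun Y P
  ident : ∀ i, IdentDistrib (Y i) (Y 0) P P
  nonneg : ∀ i, ∀ᵐ ω ∂P, 0 ≤ Y i ω
  integrable : Integrable (fun ω => |Y 0 ω| ^ p) P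
  mean : ∫ ω, Y 0 ω ∂P = c

namespace IsIIDNonneg

variable {Ω : Type*} [MeasurableSpace Ω] {P : Measure Ω} {Y : ℕ → Ω → ℝ} {c p : ℝ}

theorem mean_nonneg (h : IsIIDNonneg P Y c p) : 0 ≤ c := by
  rw [← h.mean]
  exact integral_nonneg_of_ae (h.nonneg 0)

theorem const_mul (h : IsIIDNonneg P Y c p) {a : ℝ} (ha : 0 ≤ a) :
    IsIIDNonneg P (fun i ω => a * Y i ω) (a * c) p where
  measurable i := (h.measurable i).const_mul a
  indep := h.indep.comp (fun _ x => a * x) fun _ => by fun_prop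
  ident i := (h.ident i).comp (u := fun x => a * x) (by fun_prop)
  nonneg i := by
    filter_upwards [h.nonneg i] with ω hω using mul_nonneg ha hω
  integrable := by
    simp_rw [abs_mul, Real.mul_rpow (abs_nonneg a) (abs_nonneg _)]
    exact h.integrable.const_mul _
  mean := by rw [integral_const_mul, h.mean]

theorem monotone_sum (h : IsIIDNonneg P Y c p) :
    ∀ᵐ ω ∂P, Monotone fun a : ℕ => ∑ i ∈ Finset.range a, Y i ω := by
  filter_upwards [ae_all_iff.2 h.nonneg] with ω hω
  refine monotone_nat_of_le_succ fun a => ?_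
  rw [Finset.sum_range_succ]
  linarith [hω a]

variable [IsProbabilityMeasure P]

theorem integrable_zero (h : IsIIDNonneg P Y c p) (hp : 1 ≤ p) : Integrable (Y 0) P := by
  have := integrable_abs_rpow_of_le (q := 1) (h.measurable 0) (by norm_num) hp h.integrable
  simp only [Real.rpow_one] at this
  exact (integrable_norm_iff (h.measurable 0).aestronglyMeasurable).1 this

theorem tendsto_average (h : IsIIDNonneg P Y c p) (hp : 1 ≤ p) :
    ∀ᵐ ω ∂P, Tendsto (fun a : ℕ => (∑ i ∈ Finset.range a, Y i ω) / a) atTop (𝓝 c) := by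
  have := strong_law_ae_real Y (h.integrable_zero hp)
    (fun i j hij => h.indep.indepFun hij) h.ident
  rwa [h.mean] at this

theorem tendsto_sum_atTop (h : IsIIDNonneg P Y c p) (hp : 1 ≤ p) (hc : 0 < c) :
    ∀ᵐ ω ∂P, Tendsto (fun a : ℕ => ∑ i ∈ Finset.range a, Y i ω) atTop atTop := by
  filter_upwards [h.tendsto_average hp] with ω hω
  have := hω.pos_mul_atTop hc (tendsto_natCast_atTop_atTop (R := ℝ))
  refine this.congr' ?_
  filter_upwards [eventually_gt_atTop 0] with a ha
  have : (a : ℝ) ≠ 0 := by exact_mod_cast ha.ne'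
  field_simp

/-- The weak law of large numbers along a subsequence. -/
theorem lt_sum_withHighProbability (h : IsIIDNonneg P Y c p) (hp : 1 ≤ p) (hc : 0 < c)
    {u : ℕ → ℕ} (hu : Tendsto u atTop atTop) :
    WithHighProbability P fun r ω => c / 2 * u r ≤ ∑ i ∈ Finset.range (u r), Y i ω := by
  have hm : ∀ a : ℕ, AEStronglyMeasurable
      (fun ω => (∑ i ∈ Finset.range a, Y i ω) / a) P := fun a => by
    have := h.measurable
    exact (Measurable.div_const (by fun_prop) _).aestronglyMeasurable
  have hT := tendstoInMeasure_of_tendsto_ae hm (h.tendsto_average hp)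
  have h1 := (hT (ENNReal.ofReal (c / 2)) (by simpa using hc)).comp hu
  refine WithHighProbability.mono (Q := fun r ω => ¬ ENNReal.ofReal (c / 2) ≤
    edist ((∑ i ∈ Finset.range (u r), Y i ω) / (u r : ℝ)) c) ?_ ?_
  · simp only [WithHighProbability, not_not]
    exact h1
  · filter_upwards [hu.eventually_gt_atTop 0] with r hr
    refine ae_of_all _ fun ω hω => ?_
    have hr' : (0 : ℝ) < u r := by exact_mod_cast hr
    rw [edist_dist, ENNReal.ofReal_le_ofReal_iff dist_nonneg, not_le, Real.dist_eq, abs_lt] at hω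
    have := hω.1
    rw [← le_div_iff₀ hr']
    linarith

/-- The probability that one of the first `K` blocks of length `h` has an irregular sum. -/
theorem measure_exists_block_le (hY : IsIIDNonneg P Y c p) (hp2 : 2 ≤ p) (hp4 : p ≤ 4) {η : ℝ}
    (hη : 0 < η) :
    ∃ C : ℝ, 0 ≤ C ∧ ∀ h K : ℕ, 0 < h →
      P {ω | ∃ k < K, η * h ≤ |∑ i ∈ Finset.Ico (k * h) ((k + 1) * h), (Y i ω - c)|} ≤
        ENNReal.ofReal (K * (C * (h : ℝ) ^ (-(p / 2)))) := by
  set W : ℕ → Ω → ℝ := fun i ω => Y i ω - c with hW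
  have hYi := hY.integrable_zero (by linarith)
  have hmeas : ∀ i, Measurable (W i) := fun i => (hY.measurable i).sub_const c
  have hind : iIndepFun W P := hY.indep.comp (fun _ x => x - c) fun _ => by fun_prop
  have hident : ∀ i, IdentDistrib (W i) (W 0) P P := fun i =>
    (hY.ident i).comp (u := fun x => x - c) (by fun_prop)
  have hmean : ∀ i, ∫ ω, W i ω ∂P = 0 := fun i => by
    rw [(hident i).integral_eq, hW, integral_sub hYi (integrable_const c), hY.mean]; simp
  have hint0 : Integrable (fun ω => |W 0 ω| ^ p) P := by
    simpa [hW, sub_eq_add_neg] using integrable_abs_add_rpow (hY.measurable 0)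
      (measurable_const (a := -c)) (by linarith) hY.integrable (integrable_const _)
  have hidp : ∀ i, IdentDistrib (fun ω => |W i ω| ^ p) (fun ω => |W 0 ω| ^ p) P P := fun i =>
    (hident i).comp (u := fun x => |x| ^ p) (by fun_prop)
  have hid2 : ∀ i, IdentDistrib (fun ω => W i ω ^ 2) (fun ω => W 0 ω ^ 2) P P := fun i =>
    (hident i).comp (u := fun x => x ^ 2) (by fun_prop)
  have hint : ∀ i, Integrable (fun ω => |W i ω| ^ p) P := fun i =>
    (hidp i).integrable_iff.2 hint0
  set V := ∫ ω, W 0 ω ^ 2 ∂P with hVdef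
  set M := ∫ ω, |W 0 ω| ^ p ∂P with hMdef
  have hV0 : 0 ≤ V := integral_nonneg fun ω => sq_nonneg _
  have hM0 : 0 ≤ M := integral_nonneg fun ω => by positivity
  refine ⟨(11 * ((1 + V) * V) + 20 * M) / η ^ p, by positivity, fun h K hh => ?_⟩
  have hblock : ∀ k : ℕ, P {ω | η * h ≤ |∑ i ∈ Finset.Ico (k * h) ((k + 1) * h), W i ω|} ≤
      ENNReal.ofReal ((11 * ((1 + V) * V) + 20 * M) / η ^ p * (h : ℝ) ^ (-(p / 2))) := by
    intro k
    have hcard : (Finset.Ico (k * h) ((k + 1) * h)).card = h := by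
      rw [Nat.card_Ico, add_mul, one_mul, Nat.add_sub_cancel_left]
    have := measure_abs_sum_ge_le hp2 hp4 hmeas hind hmean hint hV0
      (fun i => (hid2 i).integral_eq.le) hM0 (fun i => (hidp i).integral_eq.le) hη
      (s := Finset.Ico (k * h) ((k + 1) * h)) (by rw [← Finset.card_pos, hcard]; exact hh)
    rwa [hcard] at this
  have hset : {ω | ∃ k < K, η * h ≤ |∑ i ∈ Finset.Ico (k * h) ((k + 1) * h), W i ω|}
      = ⋃ k ∈ Finset.range K, {ω | η * h ≤ |∑ i ∈ Finset.Ico (k * h) ((k + 1) * h), W i ω|} := by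
    ext ω; simp
  rw [hset]
  refine (measure_biUnion_finset_le _ _).trans ((Finset.sum_le_sum fun k _ => hblock k).trans ?_)
  rw [Finset.sum_const, Finset.card_range, nsmul_eq_mul, ENNReal.ofReal_mul (Nat.cast_nonneg K),
    ENNReal.ofReal_natCast]

end IsIIDNonneg

namespace IsIIDNonneg

variable {Ω : Type*} [MeasurableSpace Ω] {P : Measure Ω} [IsProbabilityMeasure P]
  {Y : ℕ → Ω → ℝ} {c ε₁ ε₂ : ℝ}

/-- Up to an index of order `r²`, the partial sums over all windows whose length is of the order of
a review period are linear, with an error which is small in comparison with that period. -/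
theorem window_withHighProbability (hY : IsIIDNonneg P Y c (2 + 2 * ε₁)) (hε₁ : 0 < ε₁)
    (hε₁' : ε₁ < 1) (hε₂ : 0 < ε₂) (hε₂' : ε₂ < ε₁ / 3) {A B ε : ℝ} (hA : 0 ≤ A) (hB : 0 ≤ B)
    (hε : 0 < ε) :
    WithHighProbability P fun r ω => ∀ a d : ℕ, (a : ℝ) ≤ A * (r : ℝ) ^ 2 →
      (d : ℝ) ≤ B * reviewLength ε₂ r →
      |∑ i ∈ Finset.range (a + d), Y i ω - ∑ i ∈ Finset.range a, Y i ω - c * d|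
        ≤ ε * reviewLength ε₂ r := by
  have hc := hY.mean_nonneg
  -- Blocks have length about $\kappa l$. The error $2ch + \eta(d+2h)$ of `abs_window_sub_le` is to
  -- be at most $\varepsilon l$: with $h \le 2\kappa l$ and $d \le Bl$, these choices of $\kappa$
  -- and $\eta$ give each half at most $\varepsilon l/2$.
  set κ : ℝ := ε / (16 * (c + 1)) with hκ
  have hκ0 : 0 < κ := by positivity
  have hκc : 16 * (c + 1) * κ = ε := by rw [hκ]; field_simp
  set η : ℝ := ε / (2 * (B + 4 * κ)) with hη
  have hη0 : 0 < η := by positivity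
  have hηB : 2 * (B + 4 * κ) * η = ε := by rw [hη]; field_simp
  obtain ⟨C, hC0, hC⟩ := hY.measure_exists_block_le (by linarith) (by linarith) hη0
  set h : ℕ → ℕ := fun r => ⌈κ * reviewLength ε₂ r⌉₊ with hh
  -- The number of blocks that start at or before $(A+B)r^2$, the one at $0$ included.
  set K : ℕ → ℕ := fun r => ⌊(A + B) * (r : ℝ) ^ 2 / h r⌋₊ + 1 with hK
  have hlarge : ∀ᶠ r : ℕ in atTop, 1 ≤ r ∧ 1 / κ ≤ reviewLength ε₂ r :=
    (eventually_ge_atTop 1).and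
      ((tendsto_reviewLength (ε := ε₂) (by linarith)).eventually_ge_atTop (1 / κ))
  have hbd : ∀ r : ℕ, 1 / κ ≤ reviewLength ε₂ r → 0 < reviewLength ε₂ r ∧
      κ * reviewLength ε₂ r ≤ h r ∧ (h r : ℝ) ≤ 2 * κ * reviewLength ε₂ r := by
    intro r hr
    have h0 : 0 < reviewLength ε₂ r := lt_of_lt_of_le (by positivity) hr
    refine ⟨h0, Nat.le_ceil _, ?_⟩
    have h1 : (h r : ℝ) < κ * reviewLength ε₂ r + 1 := Nat.ceil_lt_add_one (by positivity)
    rw [div_le_iff₀ hκ0] at hr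
    linarith
  have hblocks : WithHighProbability P fun r ω => ¬ ∃ k < K r,
      η * h r ≤ |∑ i ∈ Finset.Ico (k * h r) ((k + 1) * h r), (Y i ω - c)| := by
    have ht := ENNReal.tendsto_ofReal (tendsto_sq_mul_reviewLength_rpow hε₁ hε₁' hε₂ hε₂'
      ((A + B + 2 * κ) * C * κ ^ (-(2 + ε₁))))
    rw [ENNReal.ofReal_zero] at ht
    refine tendsto_of_tendsto_of_tendsto_of_le_of_le' tendsto_const_nhds ht
      (Eventually.of_forall fun _ => zero_le) ?_
    filter_upwards [hlarge] with r hr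
    obtain ⟨hl0, hlo, hup⟩ := hbd r hr.2
    have hpos : (0 : ℝ) < h r := lt_of_lt_of_le (by positivity) hlo
    simp only [not_not]
    refine (hC (h r) (K r) (by exact_mod_cast hpos)).trans (ENNReal.ofReal_le_ofReal ?_)
    have hr2 : (0 : ℝ) ≤ (r : ℝ) ^ 2 := by positivity
    -- The summand $1$ in $K$ is absorbed by $2\kappa r^2/h$, which is at least $1$ since $h \le
    -- 2\kappa l \le 2\kappa r^2$.
    have hKr : (K r : ℝ) ≤ (A + B + 2 * κ) * (r : ℝ) ^ 2 * (h r : ℝ) ^ (-1 : ℝ) := by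
      rw [Real.rpow_neg_one, ← div_eq_mul_inv]
      have h1 : (⌊(A + B) * (r : ℝ) ^ 2 / h r⌋₊ : ℝ) ≤ (A + B) * (r : ℝ) ^ 2 / h r :=
        Nat.floor_le (by positivity)
      have h2 : 1 ≤ 2 * κ * (r : ℝ) ^ 2 / h r := by
        rw [one_le_div hpos]
        exact hup.trans (mul_le_mul_of_nonneg_left (reviewLength_le_sq hε₂.le hr.1)
          (by positivity))
      have h3 : (A + B + 2 * κ) * (r : ℝ) ^ 2 / h r
          = (A + B) * (r : ℝ) ^ 2 / h r + 2 * κ * (r : ℝ) ^ 2 / h r := by ring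
      simp only [hK]
      push_cast
      linarith
    calc (K r : ℝ) * (C * (h r : ℝ) ^ (-((2 + 2 * ε₁) / 2)))
        ≤ ((A + B + 2 * κ) * (r : ℝ) ^ 2 * (h r : ℝ) ^ (-1 : ℝ)) *
            (C * (h r : ℝ) ^ (-((2 + 2 * ε₁) / 2))) := by gcongr
      _ = (A + B + 2 * κ) * C * ((r : ℝ) ^ 2 * (h r : ℝ) ^ (-(2 + ε₁))) := by
          have : (h r : ℝ) ^ (-(2 + ε₁))
              = (h r : ℝ) ^ (-1 : ℝ) * (h r : ℝ) ^ (-((2 + 2 * ε₁) / 2)) := by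
            rw [← Real.rpow_add hpos]; congr 1; ring
          rw [this]; ring
      _ ≤ (A + B + 2 * κ) * C *
            ((r : ℝ) ^ 2 * (κ * reviewLength ε₂ r) ^ (-(2 + ε₁))) := by
          have : (h r : ℝ) ^ (-(2 + ε₁)) ≤ (κ * reviewLength ε₂ r) ^ (-(2 + ε₁)) :=
            Real.rpow_le_rpow_of_nonpos (by positivity) hlo (by linarith)
          gcongr
      _ = (A + B + 2 * κ) * C * κ ^ (-(2 + ε₁)) *
            ((r : ℝ) ^ 2 * reviewLength ε₂ r ^ (-(2 + ε₁))) := by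
          rw [Real.mul_rpow hκ0.le hl0.le]; ring
  refine hblocks.mono ?_
  filter_upwards [hlarge] with r hr
  obtain ⟨hl0, hlo, hup⟩ := hbd r hr.2
  have hpos : (0 : ℝ) < h r := lt_of_lt_of_le (by positivity) hlo
  filter_upwards [hY.monotone_sum] with ω hmono hω a d ha hd
  have hN : ((a + d : ℕ) : ℝ) ≤ (A + B) * (r : ℝ) ^ 2 := by
    push_cast
    have := mul_le_mul_of_nonneg_left (reviewLength_le_sq hε₂.le hr.1) hB
    linarith
  have key := abs_window_sub_le hmono hc hη0.le (h := h r) (by exact_mod_cast hpos)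
    (N := (A + B) * (r : ℝ) ^ 2) (fun k hk => ?_) hN
  · refine key.trans ?_
    have e1 : 2 * c * h r ≤ 2 * c * (2 * κ * reviewLength ε₂ r) := by gcongr
    have e2 : η * (d + 2 * h r) ≤ η * (B * reviewLength ε₂ r + 2 * (2 * κ * reviewLength ε₂ r)) := by
      gcongr
    have e3 : η * (B * reviewLength ε₂ r + 2 * (2 * κ * reviewLength ε₂ r))
        = ε / 2 * reviewLength ε₂ r := by rw [← hηB]; ring
    have e4 : 2 * c * (2 * κ * reviewLength ε₂ r) ≤ ε / 2 * reviewLength ε₂ r := by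
      rw [← hκc]
      have : 0 ≤ κ * reviewLength ε₂ r := by positivity
      nlinarith
    linarith
  · have hkK : k < K r := by
      rw [hK, Nat.lt_succ_iff]
      exact Nat.le_floor ((le_div_iff₀ hpos).2 hk)
    have h1 : |∑ i ∈ Finset.Ico (k * h r) ((k + 1) * h r), (Y i ω - c)| < η * h r :=
      not_le.1 fun h' => hω ⟨k, hkK, h'⟩
    have hle : k * h r ≤ (k + 1) * h r := Nat.mul_le_mul_right _ (Nat.le_succ k)
    rw [Finset.sum_sub_distrib, Finset.sum_Ico_eq_sub _ hle, Finset.sum_const, Nat.card_Ico,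
      nsmul_eq_mul, add_mul, one_mul, Nat.add_sub_cancel_left] at h1
    rw [add_mul, one_mul]
    calc _ = |∑ i ∈ Finset.range (k * h r + h r), Y i ω - ∑ i ∈ Finset.range (k * h r), Y i ω
          - h r * c| := by rw [mul_comm c]
      _ ≤ _ := h1.le

end IsIIDNonneg

/-! ### Counting processes -/

/-- The number of terms, after the first, of a nondecreasing sequence which do not exceed `t`. -/
def renewalCount (G : ℕ → ℝ) (t : ℝ) : ℕ := sSup {l : ℕ | G l ≤ t}

section RenewalCount

variable {G : ℕ → ℝ}

/-- An unbounded set of naturals has `sSup` equal to $0$; divergence of `G` is what makes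
`renewalCount` a genuine maximum. -/
theorem bddAbove_setOf_le (hlim : Tendsto G atTop atTop) (t : ℝ) :
    BddAbove {l : ℕ | G l ≤ t} := by
  obtain ⟨b, hb⟩ := eventually_atTop.1 (hlim.eventually_gt_atTop t)
  refine ⟨b, fun l hl => ?_⟩
  by_contra! h
  exact absurd hl (not_le.2 (hb l h.le))

theorem le_renewalCount (hlim : Tendsto G atTop atTop) {t : ℝ} {a : ℕ} (h : G a ≤ t) :
    a ≤ renewalCount G t := le_csSup (bddAbove_setOf_le hlim t) h

theorem apply_renewalCount_le (hlim : Tendsto G atTop atTop) (h0 : G 0 = 0) {t : ℝ} (ht : 0 ≤ t) :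
    G (renewalCount G t) ≤ t :=
  Nat.sSup_mem (s := {l : ℕ | G l ≤ t}) ⟨0, h0.trans_le ht⟩ (bddAbove_setOf_le hlim t)

theorem lt_apply_renewalCount_succ (hlim : Tendsto G atTop atTop) (t : ℝ) :
    t < G (renewalCount G t + 1) := by
  by_contra! h
  have := le_renewalCount hlim h
  omega

theorem renewalCount_mono (hlim : Tendsto G atTop atTop) (h0 : G 0 = 0) {s t : ℝ} (hs : 0 ≤ s)
    (hst : s ≤ t) : renewalCount G s ≤ renewalCount G t :=
  le_renewalCount hlim ((apply_renewalCount_le hlim h0 hs).trans hst)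

/-- Inversion of the window estimate: $G(a) \le t < G(a+1)$ at both times, so the elapsed time is
caught between two increments of $G$. The number $W$ is an a priori bound on the renewals in the
span, needed before the estimate can be used for them. -/
theorem abs_renewalCount_sub_le (hG : Monotone G) (hlim : Tendsto G atTop atTop) (h0 : G 0 = 0)
    {c e D W t₁ t₂ : ℝ} (hc : 0 ≤ c) (ht₁ : 0 ≤ t₁) (h12 : t₁ ≤ t₂) (hD : t₂ - t₁ ≤ D)
    (he : 0 ≤ e) (hW : D + 2 * e < c * (W - 2))
    (hwin : ∀ d : ℕ, (d : ℝ) ≤ W →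
      |G (renewalCount G t₁ + d) - G (renewalCount G t₁) - c * d| ≤ e) :
    |c * ((renewalCount G t₂ : ℝ) - renewalCount G t₁) - (t₂ - t₁)| ≤ c + 2 * e := by
  obtain ⟨d, hd⟩ := Nat.exists_eq_add_of_le (renewalCount_mono hlim h0 ht₁ h12)
  have a1 := apply_renewalCount_le hlim h0 ht₁
  have a2 := lt_apply_renewalCount_succ hlim t₁
  have b1 := apply_renewalCount_le hlim h0 (ht₁.trans h12)
  have b2 := lt_apply_renewalCount_succ hlim t₂
  rw [hd] at b1 b2 ⊢
  set a := renewalCount G t₁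
  have hW0 : 2 < W := by
    by_contra! hW0
    have : c * (W - 2) ≤ 0 := mul_nonpos_of_nonneg_of_nonpos hc (by linarith)
    linarith
  have w1 := abs_le.1 (hwin 1 (by push_cast; linarith))
  push_cast at w1
  -- Otherwise the first $\lfloor W\rfloor$ terms after $a$ would fit into the span, although all
  -- but one of them take at least $c(W-2) - 2e > D$.
  have hdW : (d : ℝ) + 1 ≤ W := by
    by_contra! hlt
    set w := ⌊W⌋₊ with hw
    have hw1 : (w : ℝ) ≤ W := Nat.floor_le (by linarith)
    have hw2 : W < w + 1 := Nat.lt_floor_add_one W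
    have hwd : w ≤ d := by
      have : (w : ℝ) < d + 1 := by linarith
      exact Nat.lt_succ_iff.1 (by exact_mod_cast this)
    have w2 := abs_le.1 (hwin w hw1)
    have g : G (a + w) ≤ G (a + d) := hG (by omega)
    have : c * (W - 2) ≤ c * (w - 1) := mul_le_mul_of_nonneg_left (by linarith) hc
    linarith
  have w2 := abs_le.1 (hwin d (by linarith))
  have w3 := abs_le.1 (hwin (d + 1) (by push_cast; exact hdW))
  rw [← add_assoc] at w3
  push_cast at w3 ⊢
  rw [abs_le]
  constructor <;> linarith [w1.1, w1.2, w2.1, w2.2, w3.1, w3.2]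

end RenewalCount

namespace IsIIDNonneg

variable {Ω : Type*} [MeasurableSpace Ω] {P : Measure Ω} [IsProbabilityMeasure P]
  {Y : ℕ → Ω → ℝ} {c ε₁ ε₂ : ℝ}

/-- Window estimates hold up to an index of order $r^2$; this converts a time horizon into such an
index. By the law of large numbers the first $(2A/c+1)r^2$ terms, rounded down, sum to more than
$Ar^2$; the extra $1$ in the factor pays for the rounding. -/
theorem exists_renewalCount_le_withHighProbability {p : ℝ} (hY : IsIIDNonneg P Y c p)
    (hp : 1 ≤ p) (hc : 0 < c) {A : ℝ} (hA : 0 ≤ A) :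
    ∃ A' : ℝ, 0 ≤ A' ∧ WithHighProbability P fun r ω => ∀ t : ℝ, 0 ≤ t → t ≤ A * (r : ℝ) ^ 2 →
      (renewalCount (fun a => ∑ i ∈ Finset.range a, Y i ω) t : ℝ) ≤ A' * (r : ℝ) ^ 2 := by
  refine ⟨2 * A / c + 1, by positivity, ?_⟩
  have hu : Tendsto (fun r : ℕ => ⌊(2 * A / c + 1) * (r : ℝ) ^ 2⌋₊) atTop atTop := by
    refine tendsto_nat_floor_atTop.comp (Tendsto.const_mul_atTop (by positivity) ?_)
    exact (tendsto_pow_atTop two_ne_zero).comp tendsto_natCast_atTop_atTop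
  refine (hY.lt_sum_withHighProbability hp hc hu).mono ?_
  filter_upwards [eventually_ge_atTop 2] with r hr
  filter_upwards [hY.monotone_sum, hY.tendsto_sum_atTop hp hc] with ω hmono hlim hω t ht0 ht
  have hr' : (2 : ℝ) ≤ r := by exact_mod_cast hr
  set G : ℕ → ℝ := fun a => ∑ i ∈ Finset.range a, Y i ω with hG
  set u := ⌊(2 * A / c + 1) * (r : ℝ) ^ 2⌋₊ with hudef
  have hu1 : (u : ℝ) ≤ (2 * A / c + 1) * (r : ℝ) ^ 2 := Nat.floor_le (by positivity)
  have hu2 : (2 * A / c + 1) * (r : ℝ) ^ 2 < u + 1 := Nat.lt_floor_add_one _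
  have h1 : c / 2 * ((2 * A / c + 1) * (r : ℝ) ^ 2) = A * (r : ℝ) ^ 2 + c / 2 * (r : ℝ) ^ 2 := by
    field_simp
  have h2 : t < G u := by
    have : c / 2 * ((2 * A / c + 1) * (r : ℝ) ^ 2) < c / 2 * (u + 1) := by gcongr
    have hr4 : (4 : ℝ) ≤ (r : ℝ) ^ 2 := by nlinarith
    have : c / 2 * 4 ≤ c / 2 * (r : ℝ) ^ 2 := by gcongr
    change c / 2 * u ≤ G u at hω
    linarith
  refine le_trans ?_ hu1
  have h3 := apply_renewalCount_le hlim (by simp [hG]) ht0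
  by_contra! hlt
  have : u ≤ renewalCount G t := by exact_mod_cast hlt.le
  linarith [hmono this]

/-- Over spans of time of the order of a review period, and up to a time of order `r²`, the renewal
process is linear, with an error which is small in comparison with that period. -/
theorem renewal_withHighProbability (hY : IsIIDNonneg P Y c (2 + 2 * ε₁)) (hc : 0 < c)
    (hε₁ : 0 < ε₁) (hε₁' : ε₁ < 1) (hε₂ : 0 < ε₂) (hε₂' : ε₂ < ε₁ / 3) {A κ ε : ℝ} (hA : 0 ≤ A)
    (hκ : 0 ≤ κ) (hε : 0 < ε) :
    WithHighProbability P fun r ω => ∀ t₁ t₂ : ℝ, 0 ≤ t₁ → t₁ ≤ t₂ → t₂ ≤ A * (r : ℝ) ^ 2 →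
      t₂ - t₁ ≤ κ * reviewLength ε₂ r →
      |(renewalCount (fun a => ∑ i ∈ Finset.range a, Y i ω) t₂ : ℝ)
        - renewalCount (fun a => ∑ i ∈ Finset.range a, Y i ω) t₁ - c⁻¹ * (t₂ - t₁)|
        ≤ ε * reviewLength ε₂ r := by
  have hp : (1 : ℝ) ≤ 2 + 2 * ε₁ := by linarith
  obtain ⟨A', hA', hcount⟩ := hY.exists_renewalCount_le_withHighProbability hp hc hA
  -- With window error $e = (c\varepsilon/4)l$, the inversion error $c + 2e$ is at most
  -- $c\varepsilon l$ once $l \ge 2/\varepsilon$. The coefficient in `hB` is $W/l$, chosen so that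
  -- $c(W-2) > \kappa l + 2e$ for $l \ge 1$.
  have hε' : 0 < c * ε / 4 := by positivity
  have hB : 0 ≤ (κ + 2 * (c * ε / 4) + 1) / c + 2 := by positivity
  have hwin := hY.window_withHighProbability hε₁ hε₁' hε₂ hε₂' hA' hB hε'
  refine (hcount.and hwin).mono ?_
  filter_upwards [(tendsto_reviewLength (ε := ε₂) (by linarith)).eventually_ge_atTop
    (max 1 (2 / ε))] with r hr
  filter_upwards [hY.monotone_sum, hY.tendsto_sum_atTop hp hc] with ω hmono hlim hω t₁ t₂ h0 h12 h2 hκ'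
  have hl1 : 1 ≤ reviewLength ε₂ r := (le_max_left _ _).trans hr
  have hl2 : 2 / ε ≤ reviewLength ε₂ r := (le_max_right _ _).trans hr
  rw [div_le_iff₀ hε] at hl2
  set G : ℕ → ℝ := fun a => ∑ i ∈ Finset.range a, Y i ω with hG
  set l := reviewLength ε₂ r
  have key := abs_renewalCount_sub_le hmono hlim (by simp [hG]) hc.le h0 h12 hκ'
    (e := c * ε / 4 * l) (he := by positivity) (W := ((κ + 2 * (c * ε / 4) + 1) / c + 2) * l) (hW := by
      have : c * (((κ + 2 * (c * ε / 4) + 1) / c + 2) * l - 2)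
          = κ * l + 2 * (c * ε / 4 * l) + l + 2 * c * (l - 1) := by
        field_simp; ring
      rw [this]
      nlinarith [mul_nonneg hc.le (sub_nonneg.2 hl1)])
    (hwin := fun d hd => hω.2 _ d (hω.1 t₁ h0 (h12.trans h2)) hd)
  have e : c * ((renewalCount G t₂ : ℝ) - renewalCount G t₁ - c⁻¹ * (t₂ - t₁))
      = c * ((renewalCount G t₂ : ℝ) - renewalCount G t₁) - (t₂ - t₁) := by
    field_simp
  rw [← e, abs_mul, abs_of_pos hc] at key
  refine le_of_mul_le_mul_left (key.trans ?_) hc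
  nlinarith

end IsIIDNonneg

/-! ### Linear algebra of the nominal plan, the workload pair and the policy matrix. -/

namespace Network

variable {p m n : ℕ} {N : Network p m n} {xs : Fin n → ℝ}

theorem serviceRate_pos (N : Network p m n) (j : Fin n) : 0 < N.serviceRate j :=
  one_div_pos.2 (N.meanService_pos j)

theorem inputOutput_apply (N : Network p m n) (i : Fin m) (j : Fin n) :
    N.inputOutput i j =
      ((if N.buffer j = i then 1 else 0) - N.routing j i) * N.serviceRate j := by
  simp [inputOutput, constituencyMatrix, Matrix.mul_diagonal]

theorem vecMul_inputOutput (N : Network p m n) (y : Fin m → ℝ) (j : Fin n) :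
    (y ᵥ* N.inputOutput) j =
      (y (N.buffer j) - ∑ i, N.routing j i * y i) * N.serviceRate j := by
  simp only [Matrix.vecMul, dotProduct, inputOutput_apply]
  simp only [← mul_assoc, ← Finset.sum_mul, mul_sub, Finset.sum_sub_distrib]
  congr 2
  · simp
  · exact Finset.sum_congr rfl fun i _ => mul_comm _ _

theorem vecMul_capacityMatrix (N : Network p m n) (pr : Fin p → ℝ) (j : Fin n) :
    (pr ᵥ* N.capacityMatrix) j = pr (N.server j) := by
  simp [Matrix.vecMul, dotProduct, capacityMatrix]

theorem sum_basic (xs : Fin n → ℝ) (g : Fin n → ℝ) (hg : ∀ j, ¬ 0 < xs j → g j = 0) :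
    ∑ j : Basic xs, g j = ∑ j, g j := by
  rw [← Finset.sum_filter_of_ne (p := fun j => 0 < xs j)]
  · exact (Finset.sum_subtype _ (by simp) g).symm
  · intro j _ hj
    by_contra h
    exact hj (hg j h)

/-- Extension by zero of a vector indexed by the basic activities. -/
def extendBasic (xs : Fin n → ℝ) (v : Basic xs → ℝ) (j : Fin n) : ℝ :=
  if h : 0 < xs j then v ⟨j, h⟩ else 0

theorem extendBasic_coe (v : Basic xs → ℝ) (j : Basic xs) : extendBasic xs v j = v j := by
  simp [extendBasic, j.2]

theorem mulVec_extendBasic {ι : Type*} (M : Matrix ι (Fin n) ℝ) (v : Basic xs → ℝ) (i : ι) :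
    (M *ᵥ extendBasic xs v) i = ∑ j : Basic xs, M i j * v j := by
  simp only [Matrix.mulVec, dotProduct]
  rw [← sum_basic xs]
  · simp [extendBasic_coe]
  · intro j hj
    simp [extendBasic, hj]

theorem HeavyTraffic.nonneg (h : N.HeavyTraffic xs) (j : Fin n) : 0 ≤ xs j := h.1.1.2.2 j

/-- The uniqueness of the nominal plan excludes perturbations by the basic activities which use no
more capacity. -/
theorem HeavyTraffic.eq_zero_of_mulVec (h : N.HeavyTraffic xs) {v : Basic xs → ℝ}
    (hR : N.inputOutput *ᵥ extendBasic xs v = 0)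
    (hA : ∀ k, (N.capacityMatrix *ᵥ extendBasic xs v) k ≤ 0) : v = 0 := by
  -- Basic coordinates have room and nonbasic ones do not move, so a small positive step along $v$
  -- stays feasible with $\rho = 1$.
  have hev : ∀ᶠ s : ℝ in 𝓝[>] 0, ∀ j, 0 ≤ xs j + s * extendBasic xs v j := by
    rw [eventually_all]
    intro j
    by_cases hj : 0 < xs j
    · have : Tendsto (fun s : ℝ => xs j + s * extendBasic xs v j) (𝓝[>] 0) (𝓝 (xs j)) := by
        have h1 : Continuous fun s : ℝ => xs j + s * extendBasic xs v j := by fun_prop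
        simpa using (h1.tendsto 0).mono_left nhdsWithin_le_nhds
      filter_upwards [this (Ioi_mem_nhds hj)] with s hs using (Set.mem_Ioi.1 hs).le
    · refine Eventually.of_forall fun s => ?_
      simpa [extendBasic, hj] using h.nonneg j
  obtain ⟨s, hs, hs0⟩ := (hev.and self_mem_nhdsWithin).exists
  have hs0 : 0 < s := hs0
  have hfeas : N.IsFeasible 1 (xs + s • extendBasic xs v) := by
    refine ⟨?_, fun k => ?_, fun j => ?_⟩
    · rw [Matrix.mulVec_add, Matrix.mulVec_smul, hR, smul_zero, add_zero, h.1.1.1]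
    · rw [Matrix.mulVec_add, Matrix.mulVec_smul, Pi.add_apply, Pi.smul_apply, smul_eq_mul, h.2.2 k]
      nlinarith [hA k]
    · simpa using hs j
  have heq := (h.2.1 1 _ ⟨hfeas, h.1.2⟩).2
  funext j
  have := congrFun heq j
  simp only [Pi.add_apply, Pi.smul_apply, smul_eq_mul, extendBasic_coe] at this
  have h2 : s * v j = 0 := by linarith
  simpa [hs0.ne'] using h2

section Workload

variable {y : Fin m → ℝ} {pr : Fin p → ℝ}

theorem IsWorkloadPair.dotProduct_mulVec_extendBasic (hy : N.IsWorkloadPair xs y pr)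
    (v : Basic xs → ℝ) :
    y ⬝ᵥ (N.inputOutput *ᵥ extendBasic xs v) = pr ⬝ᵥ (N.capacityMatrix *ᵥ extendBasic xs v) := by
  rw [Matrix.dotProduct_mulVec, Matrix.dotProduct_mulVec]
  refine Finset.sum_congr rfl fun j _ => ?_
  by_cases hj : 0 < xs j
  · rw [hy.1 j hj]
  · simp [extendBasic, hj]

theorem extendBasic_self (h : N.HeavyTraffic xs) : extendBasic xs (fun j => xs j) = xs := by
  funext j
  by_cases hj : 0 < xs j
  · simp [extendBasic, hj]
  · simp [extendBasic, le_antisymm (not_lt.1 hj) (h.nonneg j)]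

/-- Work arrives at unit rate. -/
theorem IsWorkloadPair.dotProduct_arrivalRate (hy : N.IsWorkloadPair xs y pr)
    (h : N.HeavyTraffic xs) : y ⬝ᵥ N.arrivalRate = 1 := by
  have := hy.dotProduct_mulVec_extendBasic fun j => xs j
  rw [extendBasic_self h, h.1.1.1] at this
  rw [this, ← hy.2]
  simp [dotProduct, h.2.2]

/-- The basic activities produce every combination of drifts and capacity consumptions which is
orthogonal to `(y, -π)`. -/
theorem exists_mulVec_extendBasic_eq (h : N.HeavyTraffic xs) (hCRP : N.CompleteResourcePooling xs)
    (hy : N.IsWorkloadPair xs y pr) {g : Fin p → ℝ} (hg : pr ⬝ᵥ g = 0) :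
    ∃ v : Basic xs → ℝ, N.inputOutput *ᵥ extendBasic xs v = 0 ∧
      N.capacityMatrix *ᵥ extendBasic xs v = g := by
  let H : Matrix (Fin m) (Basic xs) ℝ := Matrix.of fun i j => N.inputOutput i j
  let B : Matrix (Fin p) (Basic xs) ℝ := Matrix.of fun k j => N.capacityMatrix k j
  have hH : ∀ v, H *ᵥ v = N.inputOutput *ᵥ extendBasic xs v := fun v => by
    funext i; rw [mulVec_extendBasic]; rfl
  have hB : ∀ v, B *ᵥ v = N.capacityMatrix *ᵥ extendBasic xs v := fun v => by
    funext i; rw [mulVec_extendBasic]; rfl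
  -- $F$ is injective by uniqueness of the plan, so its range has dimension $b = p+m-1$. The range
  -- lies in the hyperplane orthogonal to $(y,-\pi)$, hence fills it.
  let F : (Basic xs → ℝ) →ₗ[ℝ] (Fin m → ℝ) × (Fin p → ℝ) := H.mulVecLin.prod B.mulVecLin
  have hF : Function.Injective F := by
    rw [← LinearMap.ker_eq_bot, LinearMap.ker_eq_bot']
    intro v hv
    have h1 : H *ᵥ v = 0 := congrArg Prod.fst hv
    have h2 : B *ᵥ v = 0 := congrArg Prod.snd hv
    rw [hH] at h1
    rw [hB] at h2
    exact h.eq_zero_of_mulVec h1 fun k => by rw [h2]; rfl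
  let f : (Fin m → ℝ) × (Fin p → ℝ) →ₗ[ℝ] ℝ :=
    { toFun := fun z => y ⬝ᵥ z.1 - pr ⬝ᵥ z.2
      map_add' := fun a b => by simp only [Prod.fst_add, Prod.snd_add, dotProduct_add]; ring
      map_smul' := fun c a => by
        simp only [Prod.smul_fst, Prod.smul_snd, dotProduct_smul, smul_eq_mul, RingHom.id_apply]
        ring }
  have hf : Function.Surjective f := by
    intro c
    refine ⟨(0, fun _ => -c), ?_⟩
    have : pr ⬝ᵥ (fun _ => -c) = -c := by
      simp [dotProduct, ← Finset.sum_mul, hy.2]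
    change y ⬝ᵥ 0 - pr ⬝ᵥ (fun _ => -c) = c
    rw [this]; simp
  have hle : LinearMap.range F ≤ LinearMap.ker f := by
    rintro _ ⟨v, rfl⟩
    change y ⬝ᵥ (H *ᵥ v) - pr ⬝ᵥ (B *ᵥ v) = 0
    rw [hH, hB, hy.dotProduct_mulVec_extendBasic, sub_self]
  have hfr := LinearMap.finrank_range_add_finrank_ker f
  rw [LinearMap.range_eq_top.2 hf, finrank_top] at hfr
  have hFr := LinearMap.finrank_range_of_inj hF
  have hCRP' : p + m = Fintype.card (Basic xs) + 1 := hCRP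
  have heq : LinearMap.range F = LinearMap.ker f := by
    apply Submodule.eq_of_le_of_finrank_eq hle
    simp only [Module.finrank_self, Module.finrank_prod,
      Module.finrank_fintype_fun_eq_card, Fintype.card_fin] at hfr hFr
    omega
  have hmem : ((0 : Fin m → ℝ), g) ∈ LinearMap.ker f := by
    change y ⬝ᵥ 0 - pr ⬝ᵥ g = 0
    simp [hg]
  rw [← heq] at hmem
  obtain ⟨v, hv⟩ := hmem
  refine ⟨v, ?_, ?_⟩
  · rw [← hH]; exact congrArg Prod.fst hv
  · rw [← hB]; exact congrArg Prod.snd hv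

/-- If $\pi_k \le 0 < \pi_{k'}$, the vector $-\pi_{k'}e_k + \pi_k e_{k'}$ is nonzero, nonpositive
and orthogonal to $\pi$. Some perturbation would realize it without drift, saving capacity, against
uniqueness. -/
theorem IsWorkloadPair.capacity_pos (hy : N.IsWorkloadPair xs y pr) (h : N.HeavyTraffic xs)
    (hCRP : N.CompleteResourcePooling xs) (k : Fin p) : 0 < pr k := by
  by_contra! hk
  obtain ⟨k', hk'⟩ : ∃ k', 0 < pr k' := by
    by_contra! hall
    have := Finset.sum_nonpos fun k (_ : k ∈ Finset.univ) => hall k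
    rw [hy.2] at this
    linarith
  have hne : k ≠ k' := by rintro rfl; linarith
  obtain ⟨v, hv1, hv2⟩ := exists_mulVec_extendBasic_eq h hCRP hy
    (g := Pi.single k (-pr k') + Pi.single k' (pr k)) (by simp [dotProduct_add]; ring)
  have h0 := h.eq_zero_of_mulVec hv1 fun i => by
    rw [hv2]
    simp only [Pi.add_apply, Pi.single_apply]
    split_ifs <;> linarith
  have : extendBasic xs v = 0 := by
    rw [h0]; funext j; simp [extendBasic]
  rw [this, Matrix.mulVec_zero] at hv2
  have := congrFun hv2 k
  simp [hne] at this
  linarith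

/-- A minimum principle. At a minimizer $i_0$ of $y$, the basic activity $j$ with $R_{i_0j}>0$ must
serve $i_0$, and $y_{i_0} - \sum_i P_{ji}y_i = \pi_{s(j)}/\mu_j > 0$. Since $P$ is substochastic,
this is impossible for a nonpositive minimum. -/
theorem IsWorkloadPair.workload_pos (hy : N.IsWorkloadPair xs y pr) (h : N.HeavyTraffic xs)
    (hBAB : N.BasicActivityForEachBuffer xs) (hCRP : N.CompleteResourcePooling xs)
    (hP : ∀ j i, 0 ≤ N.routing j i) (hP' : ∀ j, ∑ i, N.routing j i ≤ 1) (i : Fin m) : 0 < y i := by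
  have : Nonempty (Fin m) := ⟨i⟩
  obtain ⟨i₀, hi₀⟩ := Finite.exists_min y
  refine lt_of_lt_of_le ?_ (hi₀ i)
  obtain ⟨j, hj, hRj⟩ := hBAB i₀
  have hμ := N.serviceRate_pos j
  rw [inputOutput_apply] at hRj
  have hb : N.buffer j = i₀ := by
    by_contra hb
    rw [if_neg hb] at hRj
    nlinarith [hP j i₀, mul_nonneg (hP j i₀) hμ.le]
  have h1 := hy.1 j hj
  rw [vecMul_inputOutput, vecMul_capacityMatrix, hb] at h1
  have h2 := hy.capacity_pos h hCRP (N.server j)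
  rw [← h1] at h2
  have h3 : 0 < y i₀ - ∑ i, N.routing j i * y i := (pos_iff_pos_of_mul_pos h2).2 hμ
  have h4 : (∑ i, N.routing j i) * y i₀ ≤ ∑ i, N.routing j i * y i := by
    rw [Finset.sum_mul]
    exact Finset.sum_le_sum fun i _ => mul_le_mul_of_nonneg_left (hi₀ i) (hP j i)
  by_contra! h5
  nlinarith [hP' j]

variable [NeZero m]

theorem policyMatrix_mulVec_inl (v : Basic xs ⊕ Unit → ℝ) (i : Fin m) :
    (N.policyMatrix xs *ᵥ v) (Sum.inl i) =
      (N.inputOutput *ᵥ extendBasic xs fun j => v (Sum.inl j)) i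
        + if i = 0 then v (Sum.inr ()) else 0 := by
  rw [mulVec_extendBasic]
  simp [policyMatrix, Matrix.mulVec, dotProduct]

theorem policyMatrix_mulVec_inr (v : Basic xs ⊕ Unit → ℝ) (k : Fin p) :
    (N.policyMatrix xs *ᵥ v) (Sum.inr k) =
      (N.capacityMatrix *ᵥ extendBasic xs fun j => v (Sum.inl j)) k := by
  rw [mulVec_extendBasic]
  simp [policyMatrix, Matrix.mulVec, dotProduct]

/-- That is, $(y',-\pi')\,\Pi = (0,\dots,0,y_1)$: the last unknown, the excess held in the
designated buffer, is determined by workload alone. -/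
theorem IsWorkloadPair.dotProduct_policyMatrix_mulVec (hy : N.IsWorkloadPair xs y pr)
    (v : Basic xs ⊕ Unit → ℝ) :
    y ⬝ᵥ (fun i => (N.policyMatrix xs *ᵥ v) (Sum.inl i)) =
      pr ⬝ᵥ (fun k => (N.policyMatrix xs *ᵥ v) (Sum.inr k)) + y 0 * v (Sum.inr ()) := by
  simp only [policyMatrix_mulVec_inl, policyMatrix_mulVec_inr]
  have := hy.dotProduct_mulVec_extendBasic fun j => v (Sum.inl j)
  simp only [dotProduct, mul_add, Finset.sum_add_distrib] at this ⊢
  rw [this]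
  simp

/-- Resource pooling makes $\Pi$ square. On its kernel the last coordinate vanishes by workload, and
the others by uniqueness of the plan. So `policyInverse` is not its default value $0$. -/
theorem policyMatrix_mul_policyInverse (hy : N.IsWorkloadPair xs y pr) (h : N.HeavyTraffic xs)
    (hCRP : N.CompleteResourcePooling xs) (hy0 : y 0 ≠ 0) :
    N.policyMatrix xs * N.policyInverse xs = 1 := by
  have hker : ∀ v, N.policyMatrix xs *ᵥ v = 0 → v = 0 := by
    intro v hv
    have h1 := hy.dotProduct_policyMatrix_mulVec v
    rw [hv] at h1
    have h2 : v (Sum.inr ()) = 0 := by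
      have : y 0 * v (Sum.inr ()) = 0 := by simpa [dotProduct] using h1.symm
      simpa [hy0] using this
    have h3 : (fun j => v (Sum.inl j)) = 0 := by
      apply h.eq_zero_of_mulVec
      · funext i
        have := congrFun hv (Sum.inl i)
        rw [policyMatrix_mulVec_inl, h2] at this
        simpa using this
      · intro k
        have := congrFun hv (Sum.inr k)
        rw [policyMatrix_mulVec_inr] at this
        exact this.le
    funext j
    rcases j with j | j
    · exact congrFun h3 j
    · exact h2
  have hCRP' : p + m = Fintype.card (Basic xs) + 1 := hCRP
  have hcard : Fintype.card (Basic xs ⊕ Unit) = Fintype.card (Fin m ⊕ Fin p) := by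
    simp only [Fintype.card_sum, Fintype.card_unit, Fintype.card_fin]
    omega
  have hinj : Function.Injective (N.policyMatrix xs).mulVecLin := by
    rw [← LinearMap.ker_eq_bot, LinearMap.ker_eq_bot']
    exact hker
  have hsurj : Function.Surjective (N.policyMatrix xs).mulVec :=
    (LinearMap.injective_iff_surjective_of_finrank_eq_finrank
      (by simpa only [Module.finrank_fintype_fun_eq_card] using hcard)).1 hinj
  obtain ⟨Q, hQ⟩ := Matrix.mulVec_surjective_iff_exists_right_inverse.1 hsurj
  have hex : ∃ Q : Matrix (Basic xs ⊕ Unit) (Fin m ⊕ Fin p) ℝ,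
      N.policyMatrix xs * Q = 1 ∧ Q * N.policyMatrix xs = 1 :=
    ⟨Q, hQ, (Matrix.mul_eq_one_comm_of_card_eq _ _ _ hcard.symm).1 hQ⟩
  rw [policyInverse, dif_pos hex]
  exact hex.choose_spec.1

/-- The planned work drives the contents to the safety stocks, except that the first buffer holds
all the work in excess of the target. -/
theorem exists_eq_plannedWork (hy : N.IsWorkloadPair xs y pr) (h : N.HeavyTraffic xs)
    (hCRP : N.CompleteResourcePooling xs) (hy0 : 0 < y 0) {l δ : ℝ} {θ q : Fin m → ℝ}
    (hq : NearTarget (δ * l) θ q) :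
    ∃ x : ℝ, 0 ≤ x ∧ ∀ i, q i + N.arrivalRate i * (idleTime y θ q + l)
      - (N.inputOutput *ᵥ N.plannedWork xs y l δ θ q) i = θ i + if i = 0 then x else 0 := by
  set w : Fin m → ℝ := q + (l + idleTime y θ q) • N.arrivalRate - θ with hw
  set v : Basic xs ⊕ Unit → ℝ := N.policyInverse xs *ᵥ Sum.elim w fun _ => l with hv
  have hplan : N.plannedWork xs y l δ θ q = extendBasic xs fun j => v (Sum.inl j) := by
    funext j
    unfold plannedWork extendBasic
    split_ifs
    · rfl
    · rfl
  have hmul : N.policyMatrix xs *ᵥ v = Sum.elim w fun _ => l := by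
    rw [hv, Matrix.mulVec_mulVec, policyMatrix_mul_policyInverse hy h hCRP hy0.ne',
      Matrix.one_mulVec]
  have hwork := hy.dotProduct_policyMatrix_mulVec v
  rw [hmul] at hwork
  have h1 : y ⬝ᵥ w = l + y 0 * v (Sum.inr ()) := by
    have : pr ⬝ᵥ (fun _ => l) = l := by
      simp [dotProduct, ← Finset.sum_mul, hy.2]
    simpa [this] using hwork
  -- As work arrives at unit rate, idling covers any workload deficit; this makes the excess $x$
  -- nonnegative.
  have h2 : y ⬝ᵥ w = idleTime y θ q - y ⬝ᵥ (θ - q) + l := by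
    rw [hw, dotProduct_sub, dotProduct_add, dotProduct_smul, hy.dotProduct_arrivalRate h,
      dotProduct_sub, smul_eq_mul]
    ring
  have h3 : y ⬝ᵥ (θ - q) ≤ idleTime y θ q := le_max_right _ _
  refine ⟨v (Sum.inr ()), ?_, fun i => ?_⟩
  · have : 0 ≤ y 0 * v (Sum.inr ()) := by linarith
    exact nonneg_of_mul_nonneg_right this hy0
  · have := congrFun hmul (Sum.inl i)
    rw [policyMatrix_mulVec_inl] at this
    simp only [Sum.elim_inl, hw, Pi.add_apply, Pi.sub_apply, Pi.smul_apply, smul_eq_mul] at this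
    rw [hplan]
    linarith

end Workload

end Network

namespace Primitives

variable {p m n : ℕ} {N : Network p m n} {Ω : Type*} [MeasurableSpace Ω] {P : Measure Ω}

/-! ### The primitives as sequences of independent random variables -/

theorem routing_nonneg (X : Primitives N P) (j : Fin n) (i : Fin m) : 0 ≤ N.routing j i := by
  rw [← X.phi_prob]; exact measureReal_nonneg

theorem measurableSet_phi_eq (X : Primitives N P) (j : Fin n) (i : Fin m) :
    MeasurableSet {ω | X.phi j 0 ω = Pi.single i 1} :=
  measurableSet_eq_fun (X.phi_measurable j 0) measurable_const

theorem sum_routing_le_one [IsProbabilityMeasure P] (X : Primitives N P) (j : Fin n) :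
    ∑ i, N.routing j i ≤ 1 := by
  simp_rw [← X.phi_prob]
  rw [← measureReal_biUnion_finset]
  · exact measureReal_le_one
  · intro i _ i' _ hne
    rw [Function.onFun, Set.disjoint_left]
    intro ω h1 h2
    have h1 : X.phi j 0 ω = Pi.single i 1 := h1
    have h2 : X.phi j 0 ω = Pi.single i' 1 := h2
    rw [h1] at h2
    have := congrFun h2 i
    simp [hne] at this
  · exact fun i _ => X.measurableSet_phi_eq j i

theorem routing_le_one [IsProbabilityMeasure P] (X : Primitives N P) (j : Fin n) (i : Fin m) :
    N.routing j i ≤ 1 :=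
  (Finset.single_le_sum (fun i _ => X.routing_nonneg j i) (Finset.mem_univ i)).trans
    (X.sum_routing_le_one j)

theorem phi_apply_mem_Icc (X : Primitives N P) (j : Fin n) (a : ℕ) (i : Fin m) :
    ∀ᵐ ω ∂P, X.phi j a ω i ∈ Set.Icc (0 : ℝ) 1 := by
  filter_upwards [X.phi_mem j a] with ω hω
  rcases hω with h | ⟨i', h⟩
  · simp [h]
  · rw [h, Pi.single_apply]
    split_ifs <;> simp

theorem isIIDNonneg_service (X : Primitives N P) {ε₁ : ℝ} (hmom : X.MomentAssumption ε₁)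
    (j : Fin n) :
    IsIIDNonneg P (fun a ω => N.meanService j * X.vbar j a ω) (N.meanService j) (2 + 2 * ε₁) := by
  have h : IsIIDNonneg P (X.vbar j) 1 (2 + 2 * ε₁) :=
    { measurable := X.vbar_measurable j
      indep := X.vbar_indep j
      ident := X.vbar_ident j
      nonneg := fun a => (X.vbar_pos j a).mono fun _ h => h.le
      integrable := hmom.2 j
      mean := X.vbar_mean j }
  simpa using h.const_mul (N.meanService_pos j).le

theorem isIIDNonneg_interarrival (X : Primitives N P) {ε₁ : ℝ} (hmom : X.MomentAssumption ε₁)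
    (k : Fin m) :
    IsIIDNonneg P (fun a ω => X.ubar k a ω / N.arrivalRate k) (N.arrivalRate k)⁻¹
      (2 + 2 * ε₁) := by
  have h : IsIIDNonneg P (X.ubar k) 1 (2 + 2 * ε₁) :=
    { measurable := X.ubar_measurable k
      indep := X.ubar_indep k
      ident := X.ubar_ident k
      nonneg := fun a => (X.ubar_pos k a).mono fun _ h => h.le
      integrable := hmom.1 k
      mean := X.ubar_mean k }
  simpa [div_eq_inv_mul] using h.const_mul (inv_nonneg.2 (N.arrivalRate_nonneg k))

theorem isIIDNonneg_routing [IsProbabilityMeasure P] (X : Primitives N P) {q : ℝ} (hq : 0 ≤ q)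
    (j : Fin n) (i : Fin m) :
    IsIIDNonneg P (fun a ω => X.phi j a ω i) (N.routing j i) q where
  measurable a := (measurable_pi_apply i).comp (X.phi_measurable j a)
  indep := (X.phi_indep j).comp (fun _ x => x i) fun _ => measurable_pi_apply i
  ident a := (X.phi_ident j a).comp (measurable_pi_apply i)
  nonneg a := (X.phi_apply_mem_Icc j a i).mono fun _ h => h.1
  integrable := by
    have hm : Measurable fun ω => X.phi j 0 ω i :=
      (measurable_pi_apply i).comp (X.phi_measurable j 0)
    refine (integrable_const (1 : ℝ)).mono' (by fun_prop) ?_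
    filter_upwards [X.phi_apply_mem_Icc j 0 i] with ω hω
    rw [Real.norm_of_nonneg (by positivity), abs_of_nonneg hω.1]
    exact Real.rpow_le_one hω.1 hω.2 hq
  mean := by
    rw [← X.phi_prob, ← integral_indicator_one (X.measurableSet_phi_eq j i)]
    refine integral_congr_ae ?_
    filter_upwards [X.phi_mem j 0] with ω hω
    rcases hω with h | ⟨i', h⟩
    · rw [Set.indicator_of_notMem]
      · simp [h]
      · intro h'
        have h' : X.phi j 0 ω = Pi.single i 1 := h'
        have := congrFun (h.symm.trans h') i
        simp at this
    · rcases eq_or_ne i' i with rfl | hne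
      · rw [Set.indicator_of_mem (show ω ∈ {ω | X.phi j 0 ω = Pi.single i' 1} from h)]
        simp [h]
      · rw [Set.indicator_of_notMem]
        · simp [h, hne.symm]
        · intro h'
          have h' : X.phi j 0 ω = Pi.single i 1 := h'
          have := congrFun (h.symm.trans h') i
          simp [hne.symm] at this

/-! ### Regularity of the primitive processes over review periods -/

/-- Net number of jobs removed from buffer `i` by activity `j` in `t` units of its busy time. -/
def netOutflow (X : Primitives N P) (ω : Ω) (j : Fin n) (i : Fin m) (t : ℝ) : ℝ :=
  (if N.buffer j = i then 1 else 0) * (X.completions ω j t : ℝ)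
    - X.routed ω j (X.completions ω j t) i

/-- Departures and routing are grouped by activity, so that activity $j$ enters through one process
of drift $R_{ij}$. -/
theorem contents_eq (X : Primitives N P) (ω : Ω) (z₀ : Fin m → ℝ) (T : ℝ → Fin n → ℝ) (t : ℝ)
    (i : Fin m) :
    X.contents ω z₀ T t i =
      z₀ i + X.arrivals ω i t - ∑ j, X.netOutflow ω j i (T t j) := by
  simp only [contents, netOutflow, Finset.sum_sub_distrib, Matrix.mulVec, dotProduct,
    Network.constituencyMatrix, Matrix.of_apply]
  ring

/-- Up to time `H`, the primitive processes are linear over spans of length at most `D`, with an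
error of at most `e`. -/
def IsRegular (X : Primitives N P) (ω : Ω) (H D e : ℝ) : Prop :=
  ∀ t₁ t₂ : ℝ, 0 ≤ t₁ → t₁ ≤ t₂ → t₂ ≤ H → t₂ - t₁ ≤ D →
    (∀ k, |(X.arrivals ω k t₂ : ℝ) - X.arrivals ω k t₁ - N.arrivalRate k * (t₂ - t₁)| ≤ e) ∧
    (∀ j, |(X.completions ω j t₂ : ℝ) - X.completions ω j t₁ - N.serviceRate j * (t₂ - t₁)| ≤ e) ∧
    ∀ j i, |X.netOutflow ω j i t₂ - X.netOutflow ω j i t₁ - N.inputOutput i j * (t₂ - t₁)| ≤ e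

theorem routed_apply (X : Primitives N P) (ω : Ω) (j : Fin n) (a : ℕ) (i : Fin m) :
    X.routed ω j a i = ∑ b ∈ Finset.range a, X.phi j b ω i := by
  simp [routed, Finset.sum_apply]

variable [IsProbabilityMeasure P]

/-- For the net outflow, the error is $(C_{ij}-P_{ji})u - w$, with $u$ the error of the completions
and $w$ that of the routing sums. The window estimate is uniform in its starting index, so it may be
read at the random index $S_j(t_1)$. -/
theorem isRegular_withHighProbability (X : Primitives N P) {ε₁ ε₂ : ℝ} (hε₁ : 0 < ε₁)
    (hε₁' : ε₁ < 1) (hmom : X.MomentAssumption ε₁) (hε₂ : 0 < ε₂) (hε₂' : ε₂ < ε₁ / 3) {A κ ε : ℝ}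
    (hA : 0 ≤ A) (hκ : 0 ≤ κ) (hε : 0 < ε) :
    WithHighProbability P fun r ω =>
      X.IsRegular ω (A * (r : ℝ) ^ 2) (κ * reviewLength ε₂ r) (ε * reviewLength ε₂ r) := by
  have hE : WithHighProbability P fun r ω => ∀ k, ∀ t₁ t₂ : ℝ, 0 ≤ t₁ → t₁ ≤ t₂ →
      t₂ ≤ A * (r : ℝ) ^ 2 → t₂ - t₁ ≤ κ * reviewLength ε₂ r →
      |(X.arrivals ω k t₂ : ℝ) - X.arrivals ω k t₁ - N.arrivalRate k * (t₂ - t₁)|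
        ≤ ε * reviewLength ε₂ r := by
    refine WithHighProbability.forall_fintype fun k => ?_
    by_cases hk : N.arrivalRate k = 0
    · refine WithHighProbability.of_eventually_ae (Eventually.of_forall fun r =>
        ae_of_all _ fun ω t₁ t₂ _ _ _ _ => ?_)
      have := reviewLength_nonneg ε₂ r
      simp only [arrivals, hk, if_true]
      simp only [Nat.cast_zero, sub_self, zero_mul, abs_zero]
      positivity
    · have hk0 : 0 < N.arrivalRate k := lt_of_le_of_ne (N.arrivalRate_nonneg k) (Ne.symm hk)
      have := (X.isIIDNonneg_interarrival hmom k).renewal_withHighProbability (inv_pos.2 hk0) hε₁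
        hε₁' hε₂ hε₂' hA hκ hε
      simp only [inv_inv] at this
      refine this.mono (Eventually.of_forall fun r => ae_of_all _ fun ω hω => ?_)
      simp only [arrivals, hk, if_false]
      exact hω
  have hS : ∀ ε > 0, WithHighProbability P fun r ω => ∀ j, ∀ t₁ t₂ : ℝ, 0 ≤ t₁ → t₁ ≤ t₂ →
      t₂ ≤ A * (r : ℝ) ^ 2 → t₂ - t₁ ≤ κ * reviewLength ε₂ r →
      |(X.completions ω j t₂ : ℝ) - X.completions ω j t₁ - N.serviceRate j * (t₂ - t₁)|
        ≤ ε * reviewLength ε₂ r := by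
    intro ε hε
    refine WithHighProbability.forall_fintype fun j => ?_
    have := (X.isIIDNonneg_service hmom j).renewal_withHighProbability (N.meanService_pos j) hε₁
      hε₁' hε₂ hε₂' hA hκ hε
    simp only [← one_div] at this
    exact this
  have hF : WithHighProbability P fun r ω => ∀ j i, ∀ t₁ t₂ : ℝ, 0 ≤ t₁ → t₁ ≤ t₂ →
      t₂ ≤ A * (r : ℝ) ^ 2 → t₂ - t₁ ≤ κ * reviewLength ε₂ r →
      |X.netOutflow ω j i t₂ - X.netOutflow ω j i t₁ - N.inputOutput i j * (t₂ - t₁)|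
        ≤ ε * reviewLength ε₂ r := by
    refine WithHighProbability.forall_fintype fun j => WithHighProbability.forall_fintype fun i => ?_
    obtain ⟨A', hA', hcount⟩ := (X.isIIDNonneg_service hmom j).exists_renewalCount_le_withHighProbability
      (by linarith) (N.meanService_pos j) hA
    have hμ := N.serviceRate_pos j
    -- At most $(\mu_j\kappa + \varepsilon/2)l$ jobs are completed in a span of length $\kappa l$.
    -- Each of the two errors gets half of $\varepsilon$.
    have hwin := (X.isIIDNonneg_routing (q := 2 + 2 * ε₁) (by linarith) j i).window_withHighProbability
      hε₁ hε₁' hε₂ hε₂' hA' (B := N.serviceRate j * κ + ε / 2) (by positivity) (half_pos hε)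
    refine ((hcount.and hwin).and (hS (ε / 2) (half_pos hε))).mono (Eventually.of_forall fun r => ?_)
    filter_upwards [(X.isIIDNonneg_service hmom j).tendsto_sum_atTop (by linarith)
      (N.meanService_pos j)] with ω hlim hω t₁ t₂ h0 h12 h2 hκ'
    have s1 := hω.2 j t₁ t₂ h0 h12 h2 hκ'
    have s2 : (X.completions ω j t₁ : ℝ) ≤ A' * (r : ℝ) ^ 2 := hω.1.1 t₁ h0 (h12.trans h2)
    have s3 : X.completions ω j t₁ ≤ X.completions ω j t₂ :=
      renewalCount_mono hlim (by simp) h0 h12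
    obtain ⟨d, hd⟩ := Nat.exists_eq_add_of_le s3
    simp only [netOutflow, Network.inputOutput_apply, routed_apply]
    rw [hd] at s1 ⊢
    have s4 : (d : ℝ) ≤ (N.serviceRate j * κ + ε / 2) * reviewLength ε₂ r := by
      have := (abs_le.1 s1).2
      push_cast at this
      nlinarith [mul_le_mul_of_nonneg_left hκ' hμ.le]
    have s5 := hω.1.2 _ d s2 s4
    set S₁ := X.completions ω j t₁
    set w := ∑ b ∈ Finset.range (S₁ + d), X.phi j b ω i - ∑ b ∈ Finset.range S₁, X.phi j b ω i
      - N.routing j i * d with hw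
    push_cast at s1 ⊢
    set u := (S₁ : ℝ) + d - S₁ - N.serviceRate j * (t₂ - t₁) with hu
    set C : ℝ := if N.buffer j = i then 1 else 0 with hC
    have e : C * ((S₁ : ℝ) + d) - ∑ b ∈ Finset.range (S₁ + d), X.phi j b ω i
        - (C * S₁ - ∑ b ∈ Finset.range S₁, X.phi j b ω i)
        - (C - N.routing j i) * N.serviceRate j * (t₂ - t₁) = (C - N.routing j i) * u - w := by
      rw [hu, hw]; ring
    rw [e]
    have hCP : |C - N.routing j i| ≤ 1 := by
      have h1 := X.routing_nonneg j i
      have h2 := X.routing_le_one j i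
      rw [abs_le, hC]
      split_ifs <;> constructor <;> linarith
    calc |(C - N.routing j i) * u - w| ≤ |(C - N.routing j i) * u| + |w| := abs_sub _ _
      _ ≤ 1 * |u| + |w| := by rw [abs_mul]; gcongr
      _ ≤ ε * reviewLength ε₂ r := by linarith
  refine ((hE.and (hS ε hε)).and hF).mono (Eventually.of_forall fun r => ae_of_all _ fun ω hω => ?_)
  intro t₁ t₂ h0 h12 h2 hκ'
  exact ⟨fun k => hω.1.1 k t₁ t₂ h0 h12 h2 hκ', fun j => hω.1.2 j t₁ t₂ h0 h12 h2 hκ',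
    fun j i => hω.2 j i t₁ t₂ h0 h12 h2 hκ'⟩

end Primitives

/-! ### The discrete review policy along a regular sample path. -/

namespace Network

variable {p m n : ℕ} {N : Network p m n}

theorem le_capacityMatrix_mulVec {d : Fin n → ℝ} (hd : ∀ j, 0 ≤ d j) (j : Fin n) :
    d j ≤ (N.capacityMatrix *ᵥ d) (N.server j) := by
  simp only [Matrix.mulVec, dotProduct, capacityMatrix, Matrix.of_apply]
  refine le_trans (by simp) (Finset.single_le_sum (f := fun j' =>
    (if N.server j' = N.server j then (1 : ℝ) else 0) * d j') (fun j' _ => ?_) (Finset.mem_univ j))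
  have := hd j'
  positivity

theorem IsSchedule.le {L : ℝ} {w : Fin n → ℝ} {D : ℝ → Fin n → ℝ} (hD : N.IsSchedule L w D)
    {t : ℝ} (h0 : 0 ≤ t) (ht : t ≤ L) (j : Fin n) : D t j ≤ t := by
  have h := hD.2.2 0 t le_rfl h0 ht
  have h1 := le_capacityMatrix_mulVec (N := N) (d := D t - D 0)
    (fun j => sub_nonneg.2 (h.1 j)) j
  have h2 := h1.trans (h.2 _)
  rw [hD.1] at h2
  simpa using h2

theorem idleTime_nonneg {y θ q : Fin m → ℝ} : 0 ≤ idleTime y θ q := le_max_left _ _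

theorem idleTime_le [NeZero m] {y θ q : Fin m → ℝ} {a : ℝ} (hy : ∀ i, 0 ≤ y i) (ha : 0 ≤ a)
    (hq : NearTarget a θ q) : idleTime y θ q ≤ a * ∑ i, y i := by
  refine max_le (mul_nonneg ha (Finset.sum_nonneg fun i _ => hy i)) ?_
  rw [Finset.mul_sum]
  refine Finset.sum_le_sum fun i _ => ?_
  rw [mul_comm]
  refine mul_le_mul_of_nonneg_right ?_ (hy i)
  rw [Pi.sub_apply]
  by_cases hi : i = 0
  · subst hi; linarith [hq.1]
  · linarith [(abs_lt.1 (hq.2 i hi)).1]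

theorem NearTarget.lt [NeZero m] {θ q : Fin m → ℝ} {a : ℝ} (hq : NearTarget a θ q) (i : Fin m) :
    θ i - a < q i := by
  by_cases hi : i = 0
  · subst hi; exact hq.1
  · linarith [(abs_lt.1 (hq.2 i hi)).1]

end Network

namespace Primitives

variable {p m n : ℕ} {N : Network p m n} {Ω : Type*} [MeasurableSpace Ω] {P : Measure Ω}
  {X : Primitives N P} {ω : Ω} {T : ℝ → Fin n → ℝ}

theorem Admissible.sub_mem_Icc {z₀ : Fin m → ℝ} (h : X.Admissible ω z₀ T) {s t : ℝ} (hs : 0 ≤ s)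
    (hst : s ≤ t) (j : Fin n) : T t j - T s j ∈ Set.Icc 0 (t - s) := by
  have h1 := h.2.1 s t hs hst
  exact ⟨sub_nonneg.2 (h1.1 j), (Network.le_capacityMatrix_mulVec (N := N) (d := T t - T s)
    (fun j => sub_nonneg.2 (h1.1 j)) j).trans (h1.2 _)⟩

theorem Admissible.mem_Icc {z₀ : Fin m → ℝ} (h : X.Admissible ω z₀ T) {t : ℝ} (ht : 0 ≤ t)
    (j : Fin n) : T t j ∈ Set.Icc 0 t := by
  simpa [h.1] using h.sub_mem_Icc le_rfl ht j

/-- Over short spans of time, the contents are close to those of the fluid model. -/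
theorem IsRegular.abs_contents_sub_le {H D e : ℝ} (hreg : X.IsRegular ω H D e) {z₀ : Fin m → ℝ}
    (hadm : X.Admissible ω z₀ T) {t₁ t₂ : ℝ} (h0 : 0 ≤ t₁) (h12 : t₁ ≤ t₂) (h2 : t₂ ≤ H)
    (hD : t₂ - t₁ ≤ D) (i : Fin m) :
    |X.contents ω z₀ T t₂ i - (X.contents ω z₀ T t₁ i + N.arrivalRate i * (t₂ - t₁)
      - (N.inputOutput *ᵥ (T t₂ - T t₁)) i)| ≤ (n + 1) * e := by
  have hE := (hreg t₁ t₂ h0 h12 h2 hD).1 i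
  have hF : ∀ j, |X.netOutflow ω j i (T t₂ j) - X.netOutflow ω j i (T t₁ j)
      - N.inputOutput i j * (T t₂ j - T t₁ j)| ≤ e := fun j => by
    have hj := hadm.sub_mem_Icc h0 h12 j
    exact (hreg (T t₁ j) (T t₂ j) (hadm.mem_Icc h0 j).1 (sub_nonneg.1 hj.1)
      ((hadm.mem_Icc (h0.trans h12) j).2.trans h2) (hj.2.trans hD)).2.2 j i
  have hsum := (Finset.abs_sum_le_sum_abs (fun j => X.netOutflow ω j i (T t₂ j)
    - X.netOutflow ω j i (T t₁ j) - N.inputOutput i j * (T t₂ j - T t₁ j)) Finset.univ).trans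
    (Finset.sum_le_sum fun j _ => hF j)
  rw [Finset.sum_const, Finset.card_univ, Fintype.card_fin, nsmul_eq_mul] at hsum
  have eq : X.contents ω z₀ T t₂ i - (X.contents ω z₀ T t₁ i + N.arrivalRate i * (t₂ - t₁)
      - (N.inputOutput *ᵥ (T t₂ - T t₁)) i)
      = ((X.arrivals ω i t₂ : ℝ) - X.arrivals ω i t₁ - N.arrivalRate i * (t₂ - t₁))
        - ∑ j, (X.netOutflow ω j i (T t₂ j) - X.netOutflow ω j i (T t₁ j)
          - N.inputOutput i j * (T t₂ j - T t₁ j)) := by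
    simp only [contents_eq, Matrix.mulVec, dotProduct, Finset.sum_sub_distrib, Pi.sub_apply]
    ring
  rw [eq]
  refine (abs_sub _ _).trans ?_
  linarith

theorem IsRegular.contents_le {H D e : ℝ} (hreg : X.IsRegular ω H D e) {z₀ : Fin m → ℝ}
    (hadm : X.Admissible ω z₀ T) {t₁ t₂ : ℝ} (h0 : 0 ≤ t₁) (h12 : t₁ ≤ t₂) (h2 : t₂ ≤ H)
    (hD : t₂ - t₁ ≤ D) (i : Fin m) :
    X.contents ω z₀ T t₂ i ≤ X.contents ω z₀ T t₁ i
      + (N.arrivalRate i + ∑ j, |N.inputOutput i j|) * D + (n + 1) * e := by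
  have h := (abs_le.1 (hreg.abs_contents_sub_le hadm h0 h12 h2 hD i)).2
  have h1 : N.arrivalRate i * (t₂ - t₁) ≤ N.arrivalRate i * D :=
    mul_le_mul_of_nonneg_left hD (N.arrivalRate_nonneg i)
  have h3 : -(N.inputOutput *ᵥ (T t₂ - T t₁)) i ≤ (∑ j, |N.inputOutput i j|) * D := by
    simp only [Matrix.mulVec, dotProduct]
    rw [← Finset.sum_neg_distrib, Finset.sum_mul]
    refine Finset.sum_le_sum fun j _ => ?_
    have hj := hadm.sub_mem_Icc h0 h12 j
    rw [← neg_mul]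
    exact mul_le_mul (neg_le_abs _) (hj.2.trans hD) hj.1 (abs_nonneg _)
  linarith

/-- The cap on the number of jobs does not bind: a budget below $l$ would mean that $\lfloor
q_{b(j)}/n\rfloor$ jobs are completed in $l$ units of busy time, more than the regular number $\mu_j
l + e$. -/
theorem IsRegular.le_serviceBudget {H D e : ℝ} (hreg : X.IsRegular ω H D e) {j : Fin n}
    (hlim : Tendsto (X.serviceTime ω j) atTop atTop) {q : Fin m → ℝ} {τ l : ℝ} (hl : 0 ≤ l)
    (h0 : 0 ≤ T τ j) (hH : T τ j + l ≤ H) (hD : l ≤ D)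
    (hq : N.serviceRate j * l + e < ⌊q (N.buffer j) / n⌋₊) :
    l ≤ X.serviceBudget ω q T τ j := by
  refine le_max_of_le_right ?_
  by_contra! hlt
  have h1 : X.completions ω j (T τ j) + ⌊q (N.buffer j) / n⌋₊ ≤ X.completions ω j (T τ j + l) :=
    le_renewalCount hlim (by linarith)
  have h2 := (abs_le.1 ((hreg (T τ j) (T τ j + l) h0 (by linarith) hH (by linarith)).2.1 j)).2
  have h3 : (X.completions ω j (T τ j) : ℝ) + ⌊q (N.buffer j) / n⌋₊
      ≤ X.completions ω j (T τ j + l) := by exact_mod_cast h1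
  rw [add_sub_cancel_left] at h2
  linarith

variable [NeZero m]

/-- A review period which starts near the target state ends near it. -/
theorem IsRegular.nearTarget_next {xs : Fin n → ℝ} {y : Fin m → ℝ} {pr : Fin p → ℝ}
    (hy : N.IsWorkloadPair xs y pr) (hHT : N.HeavyTraffic xs)
    (hCRP : N.CompleteResourcePooling xs) (hy0 : 0 < y 0) {H D e l δ τ : ℝ} {θ z₀ : Fin m → ℝ}
    (hreg : X.IsRegular ω H D e) (hadm : X.Admissible ω z₀ T)
    (hlim : ∀ j, Tendsto (X.serviceTime ω j) atTop atTop)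
    (hper : X.FollowsPeriod ω xs y l δ θ z₀ T τ) (hl : 0 ≤ l) (hτ : 0 ≤ τ) (hH : τ + D ≤ H)
    (hD : Network.idleTime y θ (X.contents ω z₀ T τ) + l ≤ D)
    (hq : Network.NearTarget (δ * l) θ (X.contents ω z₀ T τ))
    (hbud : ∀ j, N.serviceRate j * l + e < ⌊X.contents ω z₀ T τ (N.buffer j) / n⌋₊)
    (he : (n + 1) * e < δ * l) :
    Network.NearTarget (δ * l) θ (X.contents ω z₀ T
      (τ + Network.idleTime y θ (X.contents ω z₀ T τ) + l)) := by
  obtain ⟨-, S, hS, hfollow, -⟩ := hper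
  have hI := Network.idleTime_nonneg (y := y) (θ := θ) (q := X.contents ω z₀ T τ)
  obtain ⟨x, hx0, hx⟩ := Network.exists_eq_plannedWork hy hHT hCRP hy0 hq
  rw [Network.processingTime, if_pos hq] at hS hfollow
  set q := X.contents ω z₀ T τ with hqdef
  set I := Network.idleTime y θ q with hIdef
  -- The schedule asks for at most $l$ units from each activity and the budget allows $l$, so the
  -- minimum is the schedule.
  have hT : T (τ + I + l) - T τ = N.plannedWork xs y l δ θ q := by
    funext j
    have hj := hadm.mem_Icc hτ j
    have hb := hreg.le_serviceBudget (hlim j) hl hj.1 (by linarith [hj.2]) (by linarith) (hbud j)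
    rw [Pi.sub_apply, hfollow hq l hl le_rfl j, min_eq_left ((hS.le hl le_rfl j).trans hb), hS.2.1]
    ring
  have hend : ∀ i, |X.contents ω z₀ T (τ + I + l) i - (θ i + if i = 0 then x else 0)| < δ * l := by
    intro i
    have := hreg.abs_contents_sub_le hadm hτ (t₂ := τ + I + l) (by linarith) (by linarith)
      (by linarith) i
    rw [hT, show τ + I + l - τ = I + l by ring, hx i] at this
    exact this.trans_lt he
  refine ⟨?_, fun i hi => ?_⟩
  · have := (abs_lt.1 (hend 0)).1
    simp only [if_true] at this
    linarith
  · simpa [hi] using hend i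

/-- As long as the primitive processes are regular, all review periods start near the target state,
and the buffers other than the first one remain of the order of a review period. -/
theorem IsRegular.contents_le_of_followsDiscreteReview {xs : Fin n → ℝ} {y : Fin m → ℝ}
    {pr : Fin p → ℝ} (hy : N.IsWorkloadPair xs y pr) (hHT : N.HeavyTraffic xs)
    (hCRP : N.CompleteResourcePooling xs) (hypos : ∀ i, 0 < y i) {H D e l δ : ℝ} {θ : Fin m → ℝ}
    (hreg : X.IsRegular ω (H + D) D e) (hadm : X.Admissible ω θ T)
    (hz : X.contents ω θ T 0 = θ) (hlim : ∀ j, Tendsto (X.serviceTime ω j) atTop atTop)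
    (hfol : X.FollowsDiscreteReview ω xs y l δ θ θ T) (hl : 0 < l) (hδ : 0 < δ)
    (hD : δ * l * ∑ i, y i + l ≤ D)
    (hbud : ∀ q : Fin m → ℝ, Network.NearTarget (δ * l) θ q →
      ∀ j, N.serviceRate j * l + e < ⌊q (N.buffer j) / n⌋₊)
    (he : (n + 1) * e < δ * l) {s : ℝ} (hs0 : 0 ≤ s) (hsH : s ≤ H) {i : Fin m} (hi : i ≠ 0) :
    X.contents ω θ T s i ≤ θ i + δ * l
      + (N.arrivalRate i + ∑ j, |N.inputOutput i j|) * D + (n + 1) * e := by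
  obtain ⟨τ, hτ0, hτ⟩ := hfol
  have hlen : ∀ k, τ k + l ≤ τ (k + 1) := fun k => by
    rw [(hτ k).1]
    have h1 := Network.idleTime_nonneg (y := y) (θ := θ) (q := X.contents ω θ T (τ k))
    have h2 : l ≤ N.processingTime xs y l δ θ (X.contents ω θ T (τ k)) := by
      unfold Network.processingTime
      split_ifs
      · exact le_rfl
      · exact le_mul_of_one_le_left hl.le (le_max_left _ _)
    linarith
  have hτl : ∀ k : ℕ, k * l ≤ τ k := fun k => by
    induction k with
    | zero => simp [hτ0]
    | succ k ih => push_cast; linarith [hlen k]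
  have hτnn : ∀ k, 0 ≤ τ k := fun k => le_trans (by positivity) (hτl k)
  have hstep : ∀ k, Network.NearTarget (δ * l) θ (X.contents ω θ T (τ k)) →
      τ (k + 1) = τ k + Network.idleTime y θ (X.contents ω θ T (τ k)) + l ∧
      Network.idleTime y θ (X.contents ω θ T (τ k)) + l ≤ D := fun k hk => by
    refine ⟨?_, ?_⟩
    · rw [(hτ k).1, Network.processingTime, if_pos hk]
    · linarith [Network.idleTime_le (fun i => (hypos i).le) (by positivity) hk]
  -- A period that starts by time $H$ may end as late as $H + D$, which is the horizon of `hreg`.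
  have hnear : ∀ k, τ k ≤ H → Network.NearTarget (δ * l) θ (X.contents ω θ T (τ k)) := by
    intro k
    induction k with
    | zero =>
      intro _
      have hδl : 0 < δ * l := by positivity
      rw [hτ0, hz]
      exact ⟨by linarith, fun i _ => by simpa using hδl⟩
    | succ k ih =>
      intro hk
      have hk' : τ k ≤ H := by linarith [hlen k]
      have hq := ih hk'
      obtain ⟨h1, h2⟩ := hstep k hq
      rw [h1]
      exact hreg.nearTarget_next hy hHT hCRP (hypos 0) hadm hlim (hτ k).2 hl.le (hτnn k)
        (by linarith) h2 hq (hbud _ hq) he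
  have hex : ∃ k, s < τ k := by
    obtain ⟨k, hk⟩ := exists_nat_gt (s / l)
    exact ⟨k, ((div_lt_iff₀ hl).1 hk).trans_le (hτl k)⟩
  classical
  obtain ⟨k, hk1, hk2⟩ : ∃ k, τ k ≤ s ∧ s < τ (k + 1) := by
    have h1 := Nat.find_spec hex
    have h2 : Nat.find hex ≠ 0 := fun h => by
      rw [h, hτ0] at h1; linarith
    obtain ⟨k, hk⟩ := Nat.exists_eq_succ_of_ne_zero h2
    rw [hk] at h1
    exact ⟨k, not_lt.1 (Nat.find_min hex (by omega)), h1⟩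
  have hq := hnear k (hk1.trans hsH)
  obtain ⟨h1, h2⟩ := hstep k hq
  have hD0 : 0 ≤ D := by
    linarith [Network.idleTime_nonneg (y := y) (θ := θ) (q := X.contents ω θ T (τ k))]
  have := hreg.contents_le hadm (hτnn k) hk1 (by linarith) (by linarith) i
  linarith [(abs_lt.1 (hq.2 i hi)).2]

end Primitives

/-! ### Almost sure properties of the sample paths, and the constants of the policy. -/

theorem renewalCount_zero {G : ℕ → ℝ} (hG : Monotone G) (hlim : Tendsto G atTop atTop)
    (h0 : G 0 = 0) (h1 : 0 < G 1) : renewalCount G 0 = 0 := by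
  by_contra h
  have := hG (Nat.one_le_iff_ne_zero.2 h)
  linarith [apply_renewalCount_le hlim h0 le_rfl]

namespace Primitives

variable {p m n : ℕ} {N : Network p m n} {Ω : Type*} [MeasurableSpace Ω] {P : Measure Ω}

/-- Sample paths of the primitives along which the arrival and completion epochs increase to
infinity. -/
structure IsTypical (X : Primitives N P) (ω : Ω) : Prop where
  service_mono : ∀ j, Monotone (X.serviceTime ω j)
  service_tendsto : ∀ j, Tendsto (X.serviceTime ω j) atTop atTop
  service_pos : ∀ j, 0 < X.serviceTime ω j 1
  arrival_mono : ∀ k, N.arrivalRate k ≠ 0 → Monotone (X.arrivalTime ω k)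
  arrival_tendsto : ∀ k, N.arrivalRate k ≠ 0 → Tendsto (X.arrivalTime ω k) atTop atTop
  arrival_pos : ∀ k, N.arrivalRate k ≠ 0 → 0 < X.arrivalTime ω k 1
  phi_mem : ∀ j a i, X.phi j a ω i ∈ Set.Icc (0 : ℝ) 1

theorem ae_isTypical [IsProbabilityMeasure P] (X : Primitives N P) {ε₁ : ℝ} (hε₁ : 0 < ε₁)
    (hmom : X.MomentAssumption ε₁) : ∀ᵐ ω ∂P, X.IsTypical ω := by
  have hp : (1 : ℝ) ≤ 2 + 2 * ε₁ := by linarith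
  have h1 : ∀ᵐ ω ∂P, ∀ j, Monotone (X.serviceTime ω j) :=
    ae_all_iff.2 fun j => (X.isIIDNonneg_service hmom j).monotone_sum
  have h2 : ∀ᵐ ω ∂P, ∀ j, Tendsto (X.serviceTime ω j) atTop atTop :=
    ae_all_iff.2 fun j => (X.isIIDNonneg_service hmom j).tendsto_sum_atTop hp (N.meanService_pos j)
  have h3 : ∀ᵐ ω ∂P, ∀ k, Monotone (X.arrivalTime ω k) :=
    ae_all_iff.2 fun k => (X.isIIDNonneg_interarrival hmom k).monotone_sum
  have h4 : ∀ᵐ ω ∂P, ∀ k, N.arrivalRate k ≠ 0 → Tendsto (X.arrivalTime ω k) atTop atTop := by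
    refine ae_all_iff.2 fun k => ?_
    by_cases hk : N.arrivalRate k = 0
    · exact ae_of_all _ fun ω h => absurd hk h
    · filter_upwards [(X.isIIDNonneg_interarrival hmom k).tendsto_sum_atTop hp
        (inv_pos.2 (lt_of_le_of_ne (N.arrivalRate_nonneg k) (Ne.symm hk)))] with ω hω _ using hω
  have h5 : ∀ᵐ ω ∂P, ∀ j a i, X.phi j a ω i ∈ Set.Icc (0 : ℝ) 1 :=
    ae_all_iff.2 fun j => ae_all_iff.2 fun a => ae_all_iff.2 fun i => X.phi_apply_mem_Icc j a i
  filter_upwards [h1, h2, h3, h4, h5, ae_all_iff.2 fun j => X.vbar_pos j 0,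
    ae_all_iff.2 fun k => X.ubar_pos k 0] with ω h1 h2 h3 h4 h5 h6 h7
  exact
    { service_mono := h1
      service_tendsto := h2
      service_pos := fun j => by
        simpa [serviceTime] using mul_pos (N.meanService_pos j) (h6 j)
      arrival_mono := fun k _ => h3 k
      arrival_tendsto := h4
      arrival_pos := fun k hk => by
        simpa [arrivalTime] using
          div_pos (h7 k) (lt_of_le_of_ne (N.arrivalRate_nonneg k) (Ne.symm hk))
      phi_mem := h5 }

variable {X : Primitives N P} {ω : Ω} {T : ℝ → Fin n → ℝ} {z₀ : Fin m → ℝ}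

theorem IsTypical.contents_zero (h : X.IsTypical ω) (hadm : X.Admissible ω z₀ T) :
    X.contents ω z₀ T 0 = z₀ := by
  have hS : ∀ j, X.completions ω j 0 = 0 := fun j =>
    renewalCount_zero (h.service_mono j) (h.service_tendsto j) (by simp [serviceTime])
      (h.service_pos j)
  have hE : ∀ k, X.arrivals ω k 0 = 0 := fun k => by
    unfold arrivals
    split_ifs with hk
    · rfl
    · exact renewalCount_zero (h.arrival_mono k hk) (h.arrival_tendsto k hk)
        (by simp [arrivalTime]) (h.arrival_pos k hk)
  funext i
  simp [contents_eq, netOutflow, routed, hadm.1, hS, hE]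

/-- A crude bound that drops departures and lets every activity work all the time and feed buffer
$i$. It gives finiteness of the supremum for each $r$. -/
theorem IsTypical.contents_le (h : X.IsTypical ω) (hadm : X.Admissible ω z₀ T) {s t : ℝ}
    (hs : 0 ≤ s) (hst : s ≤ t) (i : Fin m) :
    X.contents ω z₀ T s i ≤ z₀ i + X.arrivals ω i t + ∑ j, (X.completions ω j t : ℝ) := by
  have hE : (X.arrivals ω i s : ℝ) ≤ X.arrivals ω i t := by
    unfold arrivals
    split_ifs with hk
    · exact le_rfl
    · exact_mod_cast renewalCount_mono (h.arrival_tendsto i hk) (by simp [arrivalTime]) hs hst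
  have hF : ∀ j, -X.netOutflow ω j i (T s j) ≤ X.completions ω j t := fun j => by
    have hj := hadm.mem_Icc hs j
    have h1 : (X.completions ω j (T s j) : ℝ) ≤ X.completions ω j t := by
      exact_mod_cast renewalCount_mono (h.service_tendsto j) (by simp [serviceTime]) hj.1
        (hj.2.trans hst)
    have h2 : X.routed ω j (X.completions ω j (T s j)) i ≤ X.completions ω j (T s j) := by
      rw [routed_apply]
      refine (Finset.sum_le_sum fun a _ => (h.phi_mem j a i).2).trans ?_
      simp
    have h3 : 0 ≤ (if N.buffer j = i then (1 : ℝ) else 0) * X.completions ω j (T s j) := by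
      positivity
    unfold netOutflow
    linarith
  rw [contents_eq, sub_eq_add_neg, ← Finset.sum_neg_distrib]
  exact add_le_add (add_le_add le_rfl hE) (Finset.sum_le_sum fun j _ => hF j)

end Primitives

namespace Network

variable {p m n : ℕ} [NeZero m] {N : Network p m n} {xs : Fin n → ℝ} {y : Fin m → ℝ} {δ : ℝ}

theorem IsPerturbationConstant.lt_constC0 (hδ : N.IsPerturbationConstant xs y δ)
    (hy : ∀ i, 0 ≤ y i) : δ < N.constC0 xs := by
  have hm : (1 : ℝ) ≤ m := by exact_mod_cast Nat.one_le_iff_ne_zero.2 (NeZero.ne m)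
  have h1 : 0 ≤ (∑ i, y i) * ⨆ k, N.arrivalRate k :=
    mul_nonneg (Finset.sum_nonneg fun i _ => hy i) (Real.iSup_nonneg N.arrivalRate_nonneg)
  have h2 : (1 : ℝ) ≤ 2 * m * (1 + (∑ i, y i) * ⨆ k, N.arrivalRate k) := by nlinarith
  have h3 := (lt_div_iff₀ (by linarith)).1 hδ.2
  nlinarith [hδ.1]

/-- The safety stocks suffice to carry out the plan of a period which starts near the target. -/
theorem lt_floor_div {l e : ℝ} {θ q : Fin m → ℝ} (hn : 0 < n)
    (hδ : N.IsPerturbationConstant xs y δ) (hy : ∀ i, 0 < y i) (hl : 1 ≤ l) (he : e ≤ l)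
    (hθ : ∀ i, θ i = N.safetyFactor xs y * l) (hq : NearTarget (δ * l) θ q) (j : Fin n) :
    N.serviceRate j * l + e < ⌊q (N.buffer j) / n⌋₊ := by
  have hC0 := hδ.lt_constC0 fun i => (hy i).le
  have hδ0 := hδ.1
  have hC1 : 0 ≤ N.constC1 xs y :=
    mul_nonneg (hδ0.trans hC0).le (Real.iSup_nonneg fun i => (div_pos (hy i) (hy 0)).le)
  set M := max 1 (⨆ j, N.serviceRate j) with hM
  have hM1 : 1 ≤ M := le_max_left _ _
  have hMj : N.serviceRate j ≤ M :=
    (le_ciSup (Set.finite_range _).bddAbove j).trans (le_max_right _ _)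
  have hn1 : (1 : ℝ) ≤ n := by exact_mod_cast hn
  have hqj := hq.lt (N.buffer j)
  rw [hθ] at hqj
  have h1 : (N.serviceRate j + 2) * l ≤ q (N.buffer j) / n := by
    rw [le_div_iff₀ (by linarith)]
    -- The term $\delta$ allows for a start below $\theta$. Of the $2$, one unit pays for $e \le l$
    -- and one for the loss in the floor, at most $1 \le l$.
    have h2 : n * (N.serviceRate j + 2) + δ ≤ N.safetyFactor xs y := by
      unfold safetyFactor
      rw [← hM]
      have h3 : (2 + N.constC0 xs) * M ≤ (2 + N.constC1 xs y + N.constC0 xs) * M :=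
        mul_le_mul_of_nonneg_right (by linarith) (by linarith)
      have h4 : N.serviceRate j + 2 + δ ≤ (2 + N.constC0 xs) * M + 1 := by nlinarith
      have h5 : δ ≤ n * δ := le_mul_of_one_le_left hδ0.le hn1
      have h6 : (n : ℝ) * (N.serviceRate j + 2 + δ)
          ≤ n * ((2 + N.constC1 xs y + N.constC0 xs) * M + 1) :=
        mul_le_mul_of_nonneg_left (by linarith) (by linarith)
      linarith
    nlinarith [mul_le_mul_of_nonneg_right h2 (zero_le_one.trans hl)]
  have h2 := Nat.lt_floor_add_one (q (N.buffer j) / n)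
  nlinarith

end Network

end

/-! ### State space collapse. -/

theorem theorem1 {p m n : ℕ} [NeZero m] (N : Network p m n)
    {Ω : Type*} [MeasurableSpace Ω] (P : Measure Ω) [IsProbabilityMeasure P]
    (X : Primitives N P)
    (xs : Fin n → ℝ) (hHT : N.HeavyTraffic xs) (hBAB : N.BasicActivityForEachBuffer xs)
    (hCRP : N.CompleteResourcePooling xs)
    (y : Fin m → ℝ) (pr : Fin p → ℝ) (hy : N.IsWorkloadPair xs y pr)
    (δ : ℝ) (hδ : N.IsPerturbationConstant xs y δ)
    (ε₁ : ℝ) (hε₁ : 0 < ε₁) (hε₁' : ε₁ < 1) (hmom : X.MomentAssumption ε₁)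
    (ε₂ : ℝ) (hε₂ : 0 < ε₂) (hε₂' : ε₂ < ε₁ / 3)
    (T : ℕ → Ω → ℝ → Fin n → ℝ)
    (hTmeas : ∀ r : ℕ, 1 ≤ r → ∀ s : ℝ, 0 ≤ s → Measurable fun ω => T r ω s)
    (hT : ∀ r : ℕ, 1 ≤ r → ∀ᵐ ω ∂P,
      X.Admissible ω (safetyStock N xs y ε₂ r) (T r ω) ∧
      X.FollowsDiscreteReview ω xs y (reviewLength ε₂ r) δ (safetyStock N xs y ε₂ r)
        (safetyStock N xs y ε₂ r) (T r ω))
    (t : ℝ) (ht : 0 < t) (k : Fin m) (hk : k ≠ 0) :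
    (∀ r : ℕ, 1 ≤ r → ∀ᵐ ω ∂P,
      BddAbove ((fun s => scaledContents X xs y ε₂ r ω (T r ω) s k) '' Set.Icc 0 t)) ∧
    TendstoInMeasure P
      (fun (r : ℕ) (ω : Ω) =>
        sSup ((fun s => scaledContents X xs y ε₂ r ω (T r ω) s k) '' Set.Icc 0 t))
      atTop (fun _ => 0) := by

  have hε₂1 : ε₂ < 1 := by linarith
  have hypos := hy.workload_pos hHT hBAB hCRP X.routing_nonneg X.sum_routing_le_one
  have htyp := X.ae_isTypical hε₁ hmom
  have hn : 0 < n := by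
    obtain ⟨j, -⟩ := N.buffer_surjective 0
    exact j.pos
  have hδ0 := hδ.1
  have hsum0 : 0 ≤ ∑ i, y i := Finset.sum_nonneg fun i _ => (hypos i).le
  have htime : ∀ r : ℕ, ∀ s ∈ Set.Icc 0 t, 0 ≤ (r : ℝ) ^ 2 * s ∧ (r : ℝ) ^ 2 * s ≤ (r : ℝ) ^ 2 * t :=
    fun r s hs => ⟨mul_nonneg (by positivity) hs.1, mul_le_mul_of_nonneg_left hs.2 (by positivity)⟩
  refine ⟨fun r hr => ?_, ?_⟩
  · filter_upwards [htyp, hT r hr] with ω hω hTω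
    refine ⟨(safetyStock N xs y ε₂ r k + X.arrivals ω k ((r : ℝ) ^ 2 * t)
      + ∑ j, (X.completions ω j ((r : ℝ) ^ 2 * t) : ℝ)) / r, ?_⟩
    rintro _ ⟨s, hs, rfl⟩
    obtain ⟨hs0, hst⟩ := htime r s hs
    exact div_le_div_of_nonneg_right (hω.contents_le hTω.1 hs0 hst k) (Nat.cast_nonneg r)
  -- A period that starts near the target lasts at most $\kappa l$: idling at most $\delta l\sum_i
  -- y_i$, then processing for $l$.
  · set κ : ℝ := δ * (∑ i, y i) + 1 with hκ
    have hκ0 : 0 ≤ κ := by positivity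
    -- The bound $1$ serves the safety stocks, the other one the return to the target.
    set ε : ℝ := min 1 (δ / (2 * (n + 1))) with hεdef
    have hε : 0 < ε := by positivity
    have hε1 : ε ≤ 1 := min_le_left _ _
    have hεδ : (n + 1) * ε < δ := by
      have h1 : ε ≤ δ / (2 * (n + 1)) := min_le_right _ _
      rw [le_div_iff₀ (by positivity)] at h1
      linarith
    have hreg := X.isRegular_withHighProbability hε₁ hε₁' hmom hε₂ hε₂' (A := t + κ) (κ := κ)
      (by positivity) hκ0 hε
    set c : ℝ := N.safetyFactor xs y + δ + (N.arrivalRate k + ∑ j, |N.inputOutput k j|) * κ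
      + (n + 1) * ε with hc
    have hbound : WithHighProbability P fun r ω => ∀ s ∈ Set.Icc 0 t,
        scaledContents X xs y ε₂ r ω (T r ω) s k ∈ Set.Icc 0 (c * reviewLength ε₂ r / r) := by
      refine hreg.mono ?_
      filter_upwards [eventually_ge_atTop 1,
        (tendsto_reviewLength hε₂1).eventually_ge_atTop 1] with r hr hl
      filter_upwards [htyp, hT r hr] with ω hω hTω hregω s hs
      obtain ⟨hs0, hst⟩ := htime r s hs
      refine ⟨div_nonneg (hTω.1.2.2 _ hs0 k) (Nat.cast_nonneg r), ?_⟩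
      refine div_le_div_of_nonneg_right ?_ (Nat.cast_nonneg r)
      set l := reviewLength ε₂ r with hldef
      have hl0 : 0 < l := zero_lt_one.trans_le hl
      -- Since $l \le r^2$, the horizon $(t+\kappa)r^2$ leaves room for the last period to overrun
      -- $r^2t$.
      have hregω' : X.IsRegular ω ((r : ℝ) ^ 2 * t + κ * l) (κ * l) (ε * l) := by
        intro t₁ t₂ h0 h12 h2 hD
        refine hregω t₁ t₂ h0 h12 (h2.trans ?_) hD
        have := mul_le_mul_of_nonneg_left (reviewLength_le_sq hε₂.le hr) hκ0
        linarith
      have := hregω'.contents_le_of_followsDiscreteReview hy hHT hCRP hypos hTω.1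
        (hω.contents_zero hTω.1) hω.service_tendsto hTω.2 hl0 hδ0
        (le_of_eq (by rw [hκ]; ring))
        (fun q hq j => Network.lt_floor_div hn hδ hypos hl (by nlinarith) (fun _ => rfl) hq j)
        (by nlinarith) hs0 hst hk
      refine this.trans (le_of_eq ?_)
      rw [hc]
      simp only [safetyStock]
      ring
    intro a ha
    refine hbound.mono (Q' := fun r ω => ¬ a ≤ edist (sSup ((fun s =>
      scaledContents X xs y ε₂ r ω (T r ω) s k) '' Set.Icc 0 t)) 0) ?_ |>.congr fun r => by
        simp only [not_not]
    have hlim := ENNReal.tendsto_ofReal (tendsto_reviewLength_div hε₂ c)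
    rw [ENNReal.ofReal_zero] at hlim
    filter_upwards [hlim.eventually_lt_const ha] with r hr
    refine ae_of_all _ fun ω hω => ?_
    have h0 : 0 ≤ sSup ((fun s => scaledContents X xs y ε₂ r ω (T r ω) s k) '' Set.Icc 0 t) :=
      Real.sSup_nonneg (by rintro _ ⟨s, hs, rfl⟩; exact (hω s hs).1)
    have h1 : sSup ((fun s => scaledContents X xs y ε₂ r ω (T r ω) s k) '' Set.Icc 0 t)
        ≤ c * reviewLength ε₂ r / r :=
      csSup_le ⟨_, Set.mem_image_of_mem _ (Set.left_mem_Icc.2 ht.le)⟩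
        (by rintro _ ⟨s, hs, rfl⟩; exact (hω s hs).2)
    rw [not_le, edist_dist, Real.dist_eq, sub_zero, abs_of_nonneg h0]
    exact (ENNReal.ofReal_le_ofReal h1).trans_lt hr
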